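/- **Definitions.** A timed word over a finite alphabet $\Sigma$ is a non-empty finite sequence $(a_1,t_1)\dots(a_n,t_n)\in(\Sigma\times\mathbb{R}_{\ge 0})^+$ with $t_1\le\dots\le t_n$. A clock constraint over a finite set $X$ of clocks is a (possibly empty) finite conjunction of atoms $x\sim c$ with $x\in X$, $c\in\mathbb{N}$ and ${\sim}\in\{<,\le,=,\ge,>\}$; the empty conjunction is $\mathtt{true}$. A timed pushdown automaton $\mathcal{A}=(\Sigma,\Gamma,\mathcal{L},\mathcal{L}_0,\mathcal{L}_f,X,E)$ consists of a finite input alphabet $\Sigma$, a finite stack alphabet $\Gamma$, a finite set $\mathcal{L}$ of locations, sets $\mathcal{L}_0,\mathcal{L}_f\subseteq\mathcal{L}$ of initial and accepting locations, a finite set $X$ of clocks, and a finite set $E$ of edges $(l,a,\phi,\mathsf{op},\lambda,l')$, where $l,l'\in\mathcal{L}$, $a\in\Sigma$, $\phi$ is a clock constraint over $X$, $\lambda\subseteq X$, and $\mathsf{op}$ is $pop(\gamma)$ or $push(\gamma)$ with $\gamma\in\Gamma$, or $noop$, or $empty?$. A state is a triple $(l,\nu,u)$ with $l\in\mathcal{L}$,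 $\nu:X\to\mathbb{R}_{\ge 0}$, $u\in\Gamma^*$. There is a transition from $(l,\nu,u)$ to $(l',\nu',u')$ with delay $\delta\in\mathbb{R}_{\ge 0}$ and symbol $a$ if for some edge $(l,a,\phi,\mathsf{op},\lambda,l')\in E$ the valuation $\nu+\delta$ satisfies $\phi$, $\nu'$ is obtained from $\nu+\delta$ by setting the clocks in $\lambda$ to $0$, and $u=\gamma u'$ if $\mathsf{op}=pop(\gamma)$, $u'=\gamma u$ if $\mathsf{op}=push(\gamma)$, $u'=u$ if $\mathsf{op}=noop$, and $u=u'=\varepsilon$ if $\mathsf{op}=empty?$. The timed language $L(\mathcal{A})$ is the set of all timed words $(a_1,\delta_1)(a_2,\delta_1+\delta_2)\dots(a_n,\delta_1+\dots+\delta_n)$ such that there is a sequence of $n$ consecutive transitions with delays $\delta_i$ and symbols $a_i$ that starts in a state with initial location, all clocks $0$ and empty stack and ends in a state with accepting location. A *timed automaton* is a timed pushdown automaton without a stack: $\Gamma=\emptyset$ and every edge has operation $noop$. A *timed visibly one-counter net* is a timed pushdown automaton with $|\Gamma|=1$, without edges with operation $empty?$, for which $\Sigma$ can be partitioned into pairwise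 disjoint (possibly empty) sets $\Sigma_{\mathsf{int}},\Sigma_{\mathsf{call}},\Sigma_{\mathsf{ret}}$ such that, for every edge, its symbol is in $\Sigma_{\mathsf{int}}$, $\Sigma_{\mathsf{call}}$ or $\Sigma_{\mathsf{ret}}$ if and only if its operation is $noop$, a push, or a pop (or $empty?$), respectively. A timed visibly one-counter net with no clocks is *deterministic* if no two different edges have the same source location and the same input symbol. **Theorem.** The language inclusion problem "given a timed visibly one-counter net $\mathcal{A}$ and a timed automaton $\mathcal{B}$ over the same input alphabet, does $L(\mathcal{A})\subseteq L(\mathcal{B})$ hold?" is undecidable. It remains undecidable when the instances are restricted to pairs $(\mathcal{A},\mathcal{B})$ such that $\mathcal{A}$ is deterministic and has no clocks and $\mathcal{B}$ has at most one clock. That is, for neither of the two sets of instances is there an algorithm that halts on every instance in the set and correctly answers whether $L(\mathcal{A})\subseteq L(\mathcal{B})$. -/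

import Mathlib

open scoped NNReal

/-!
# Timed pushdown automata over finite timed words

Input symbols, stack symbols, locations and clocks are named by natural numbers, and finite sets
and finite relations are presented by lists (only membership matters). This makes every automaton
a finite object that can be handed to an algorithm.
-/

namespace Timed

/-- The comparison relations `<, ≤, =, ≥, >` of clock constraints. -/
inductive Cmp where
  | lt | le | eq | ge | gt

/-- `r.Holds v c` : the value `v` stands in the relation `r` to the constant `c`. -/
def Cmp.Holds : Cmp → ℝ≥0 → ℕ → Prop
  | .lt, v, c => v < c
  | .le, v, c => v ≤ c
  | .eq, v, c => v = c
  | .ge, v, c => (c : ℝ≥0) ≤ v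
  | .gt, v, c => (c : ℝ≥0) < v

/-- The atomic clock constraint `clock ∼ const`. -/
structure Atom where
  clock : ℕ
  rel : Cmp
  const : ℕ

/-- A clock constraint: a conjunction of atoms. The empty conjunction is `true`. -/
abbrev Guard := List Atom

/-- The stack operations. -/
inductive Op where
  | pop (γ : ℕ)
  | push (γ : ℕ)
  | noop
  | isEmpty

/-- An edge `(src, sym, guard, op, reset, tgt)`; `reset` lists the clocks to be reset. -/
structure Edge where
  src : ℕ
  sym : ℕ
  guard : Guard
  op : Op
  reset : List ℕ
  tgt : ℕ

/-- The data `(Σ, Γ, L, L₀, L_f, X, E)` of a timed pushdown automaton. -/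
structure TPDA where
  alphabet : List ℕ
  stack : List ℕ
  locs : List ℕ
  init : List ℕ
  final : List ℕ
  clocks : List ℕ
  edges : List Edge

/-! ### Semantics -/

/-- A clock valuation. Only its values on the clocks of the automaton at hand matter. -/
abbrev Valuation := ℕ → ℝ≥0

/-- `ν ⊨ φ`. -/
def Guard.Sat (φ : Guard) (ν : Valuation) : Prop :=
  ∀ a ∈ φ, a.rel.Holds (ν a.clock) a.const

/-- `ν + δ`. -/
def Valuation.delay (ν : Valuation) (δ : ℝ≥0) : Valuation := fun x => ν x + δ

/-- `ν[lam := 0]`. -/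
def Valuation.reset (ν : Valuation) (lam : List ℕ) : Valuation :=
  fun x => if x ∈ lam then 0 else ν x

/-- The effect of a stack operation; the top of the stack is the head of the list. -/
def Op.Effect : Op → List ℕ → List ℕ → Prop
  | .pop γ, u, u' => u = γ :: u'
  | .push γ, u, u' => u' = γ :: u
  | .noop, u, u' => u' = u
  | .isEmpty, u, u' => u = [] ∧ u' = []

/-- A state: location, clock valuation, stack content. -/
structure State where
  loc : ℕ
  val : Valuation
  stk : List ℕ

namespace TPDA

/-- All components of the automaton refer only to its own symbols, locations and clocks. -/
structure WellFormed (A : TPDA) : Prop where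
  init_sub : ∀ l ∈ A.init, l ∈ A.locs
  final_sub : ∀ l ∈ A.final, l ∈ A.locs
  src_mem : ∀ e ∈ A.edges, e.src ∈ A.locs
  tgt_mem : ∀ e ∈ A.edges, e.tgt ∈ A.locs
  sym_mem : ∀ e ∈ A.edges, e.sym ∈ A.alphabet
  guard_mem : ∀ e ∈ A.edges, ∀ a ∈ e.guard, a.clock ∈ A.clocks
  reset_mem : ∀ e ∈ A.edges, ∀ x ∈ e.reset, x ∈ A.clocks
  pop_mem : ∀ e ∈ A.edges, ∀ γ, e.op = .pop γ → γ ∈ A.stack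
  push_mem : ∀ e ∈ A.edges, ∀ γ, e.op = .push γ → γ ∈ A.stack

/-- The transition relation: after a delay `δ`, an edge reading `a` is taken. -/
def Step (A : TPDA) (s : State) (δ : ℝ≥0) (a : ℕ) (s' : State) : Prop :=
  ∃ e ∈ A.edges, e.src = s.loc ∧ e.sym = a ∧ e.tgt = s'.loc ∧
    e.guard.Sat (s.val.delay δ) ∧
    s'.val = (s.val.delay δ).reset e.reset ∧
    e.op.Effect s.stk s'.stk

/-- `A.Run s ρ s'` : there is a run from `s` to `s'` whose successive pairs (input symbol, delay)
are `ρ`. -/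
inductive Run (A : TPDA) : State → List (ℕ × ℝ≥0) → State → Prop
  | nil (s : State) : Run A s [] s
  | cons {s s' s'' : State} {δ : ℝ≥0} {a : ℕ} {ρ : List (ℕ × ℝ≥0)} :
      A.Step s δ a s' → Run A s' ρ s'' → Run A s ((a, δ) :: ρ) s''

end TPDA

/-- Turns delays into time stamps, starting at time `t`: the `i`-th symbol gets the time stamp
`t + δ₁ + ⋯ + δᵢ`. -/
def stamp : ℝ≥0 → List (ℕ × ℝ≥0) → List (ℕ × ℝ≥0)
  | _, [] => []
  | t, (a, δ) :: ρ => (a, t + δ) :: stamp (t + δ) ρ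

/-- Timed words over the alphabet `S`: non-empty finite sequences of pairs (symbol, time stamp)
with non-decreasing time stamps. -/
def TimedWords (S : List ℕ) : Set (List (ℕ × ℝ≥0)) :=
  {w | w ≠ [] ∧ (∀ p ∈ w, p.1 ∈ S) ∧ (w.map Prod.snd).Pairwise (· ≤ ·)}

namespace TPDA

/-- The timed language accepted by `A`. -/
def language (A : TPDA) : Set (List (ℕ × ℝ≥0)) :=
  {w ∈ TimedWords A.alphabet | ∃ (s s' : State) (ρ : List (ℕ × ℝ≥0)),
    s.loc ∈ A.init ∧ (∀ x ∈ A.clocks, s.val x = 0) ∧ s.stk = [] ∧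
    A.Run s ρ s' ∧ s'.loc ∈ A.final ∧ stamp 0 ρ = w}

/-! ### Subclasses -/

/-- One-counter automata: the stack alphabet is a singleton. -/
def IsOneCounter (A : TPDA) : Prop := ∃ γ, ∀ x, x ∈ A.stack ↔ x = γ

/-- No zero tests. -/
def NoZeroTest (A : TPDA) : Prop := ∀ e ∈ A.edges, e.op ≠ .isEmpty

/-- Visibly: the input alphabet splits into internal, call and return symbols, which determine the
kind of stack operation. -/
def IsVisibly (A : TPDA) : Prop :=
  ∃ int call ret : Set ℕ,
    {a | a ∈ A.alphabet} = int ∪ call ∪ ret ∧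
    Disjoint int call ∧ Disjoint int ret ∧ Disjoint call ret ∧
    ∀ e ∈ A.edges,
      (e.sym ∈ int ↔ e.op = .noop) ∧
      (e.sym ∈ call ↔ ∃ γ, e.op = .push γ) ∧
      (e.sym ∈ ret ↔ e.op = .isEmpty ∨ ∃ γ, e.op = .pop γ)

/-- Timed visibly one-counter nets. -/
def IsTimedVisiblyOneCounterNet (A : TPDA) : Prop :=
  A.WellFormed ∧ A.IsOneCounter ∧ A.NoZeroTest ∧ A.IsVisibly

/-- Timed automata: timed pushdown automata that do not have a stack. -/
def IsTimedAutomaton (A : TPDA) : Prop :=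
  A.WellFormed ∧ A.stack = [] ∧ ∀ e ∈ A.edges, e.op = .noop

/-- No clocks. -/
def Clockless (A : TPDA) : Prop := A.clocks = []

/-- At most one clock. -/
def AtMostOneClock (A : TPDA) : Prop := A.clocks.toFinset.card ≤ 1

/-- Determinism, for clockless visibly one-counter automata: two different edges with the same
source and the same input symbol are a decrement and a zero test. -/
def IsDeterministic (A : TPDA) : Prop :=
  ∀ e ∈ A.edges, ∀ e' ∈ A.edges, e.src = e'.src → e.sym = e'.sym → e ≠ e' →
    ((∃ γ, e.op = .pop γ) ∧ e'.op = .isEmpty) ∨ (e.op = .isEmpty ∧ ∃ γ, e'.op = .pop γ)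

/-- `A` and `B` have the same input alphabet. -/
def SameAlphabet (A B : TPDA) : Prop := ∀ a, a ∈ A.alphabet ↔ a ∈ B.alphabet

end TPDA

/-! ### Automata as inputs of algorithms -/

/-- Comparison relations are numbered from `0` to `4`. -/
def Cmp.equivFin : Cmp ≃ Fin 5 where
  toFun
    | .lt => 0
    | .le => 1
    | .eq => 2
    | .ge => 3
    | .gt => 4
  invFun
    | 0 => .lt
    | 1 => .le
    | 2 => .eq
    | 3 => .ge
    | 4 => .gt
  left_inv r := by cases r <;> rfl
  right_inv i := by fin_cases i <;> rfl

/-- Atoms as triples. -/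
def Atom.equivProd : Atom ≃ ℕ × Cmp × ℕ where
  toFun a := (a.clock, a.rel, a.const)
  invFun p := ⟨p.1, p.2.1, p.2.2⟩
  left_inv _ := rfl
  right_inv _ := rfl

/-- Stack operations as elements of a disjoint union. -/
def Op.equivSum : Op ≃ (ℕ ⊕ ℕ) ⊕ Bool where
  toFun
    | .pop γ => .inl (.inl γ)
    | .push γ => .inl (.inr γ)
    | .noop => .inr false
    | .isEmpty => .inr true
  invFun
    | .inl (.inl γ) => .pop γ
    | .inl (.inr γ) => .push γ
    | .inr false => .noop
    | .inr true => .isEmpty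
  left_inv o := by cases o <;> rfl
  right_inv x := by rcases x with (γ | γ) | (_ | _) <;> rfl

instance : Primcodable Cmp := Primcodable.ofEquiv _ Cmp.equivFin
instance : Primcodable Atom := Primcodable.ofEquiv _ Atom.equivProd
instance : Primcodable Op := Primcodable.ofEquiv _ Op.equivSum

/-- Edges as tuples. -/
def Edge.equivProd : Edge ≃ ℕ × ℕ × List Atom × Op × List ℕ × ℕ where
  toFun e := (e.src, e.sym, e.guard, e.op, e.reset, e.tgt)
  invFun p := ⟨p.1, p.2.1, p.2.2.1, p.2.2.2.1, p.2.2.2.2.1, p.2.2.2.2.2⟩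
  left_inv _ := rfl
  right_inv _ := rfl

instance : Primcodable Edge := Primcodable.ofEquiv _ Edge.equivProd

/-- Automata as tuples. -/
def TPDA.equivProd :
    TPDA ≃ List ℕ × List ℕ × List ℕ × List ℕ × List ℕ × List ℕ × List Edge where
  toFun A := (A.alphabet, A.stack, A.locs, A.init, A.final, A.clocks, A.edges)
  invFun p := ⟨p.1, p.2.1, p.2.2.1, p.2.2.2.1, p.2.2.2.2.1, p.2.2.2.2.2.1, p.2.2.2.2.2.2⟩
  left_inv _ := rfl
  right_inv _ := rfl

instance : Primcodable TPDA := Primcodable.ofEquiv _ TPDA.equivProd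

/-- The decision problem with set of instances `D` and question `P` is decidable: some algorithm
halts on every instance in `D` and answers whether `P` holds. Nothing is asked of the algorithm on
inputs outside `D`. -/
def DecidableOn {α : Type} [Primcodable α] (D : Set α) (P : α → Prop) : Prop :=
  ∃ f : α →. Bool, Partrec f ∧ ∀ x ∈ D, ∃ b ∈ f x, (b = true ↔ P x)

/-- Pairs `(A, B)` of a timed visibly one-counter net `A` and a timed automaton `B` over the same
input alphabet. -/
def netAutomatonPairs : Set (TPDA × TPDA) :=
  {p | p.1.IsTimedVisiblyOneCounterNet ∧ p.2.IsTimedAutomaton ∧ p.1.SameAlphabet p.2}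

/-- Those pairs `(A, B)` for which `A` is deterministic and has no clocks, and `B` has at most one
clock. -/
def restrictedPairs : Set (TPDA × TPDA) :=
  {p ∈ netAutomatonPairs | p.1.Clockless ∧ p.1.IsDeterministic ∧ p.2.AtMostOneClock}

end Timed

/-! Fix a Turing machine with finitely many states whose halting problem is undecidable already on
the tapes `c₀ c₁ c₂ᵐ`. The words of the net that the timed automaton rejects are to be the halting
computations on such a tape, so that inclusion means that the machine does not halt.

A computation inside a window of `C` cells is written as one sequence, row after row, with a marker
between consecutive rows. Each later cell is then a function `F` of three consecutive earlier cells
at a fixed distance (`IsHelix`), and row ends need no separate treatment. As a timed word: one time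
unit after every event that is not a return comes an event with the cell that `F` prescribes. One
clock suffices to accept the words that violate this: `faultAutomaton` guesses an event, resets the
clock, and accepts if the prescribed successor is missing one unit later. It also accepts if two
consecutive events are simultaneous.

A word without such faults might still contain surplus events that are successors of nothing. The
counter excludes them. The net reads `C` calls that spell the first row, then internal events, then
returns, the first with a halted cell; a counter that cannot become negative allows at most `C`
returns. Let `q` events precede the returns and let `n` be the length. Each of the `q` events has a
successor that is not a call, and these successors are distinct because time strictly increases.
They lie among the events `C, …, n - 1`, and `n ≤ q + C`, so all places are taken and event `i` has
successor `i + C` (`eq_helix_rule_of_faultless`). Hence the word follows a helix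
(`eq_helix_of_faultless`), and its halted cell comes from a halting run (`eval_dom_of_helix`), since
a head that leaves the window vanishes for good. Conversely, a halting run fits into a wide enough
window and yields a faultless word (`exists_isHalted_helix`, `exists_faultless_of_helix`). This
gives `language_subset_iff_not_halts`.

The machine being fixed, the timed automaton is constant and the net depends on `m` only through a
chain of edges, so the reduction is computable. Its instances are restricted ones, which settles
both problems. -/

namespace Timed

/-! ### A universal Turing machine with finitely many states -/

section Universal

open Turing

lemma natCast_two_pow_num (m : ℕ) :
    ((2 ^ m : ℕ) : Num) = Num.pos (PosNum.bit0^[m] PosNum.one) := by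
  have h : ∀ m : ℕ, ((Num.pos (PosNum.bit0^[m] PosNum.one) : Num) : ℕ) = 2 ^ m := by
    intro m
    induction m with
    | zero => rfl
    | succ m ih =>
      rw [Function.iterate_succ_apply', pow_succ, ← ih]
      simp only [Num.cast_pos, PosNum.cast_bit0]
      ring
  rw [← h m, Num.of_to_nat]

/-- Powers of two serve as inputs because all their binary digits but one are equal: the tape then
varies only in the length of one block. -/
lemma trNat_two_pow (m : ℕ) :
    PartrecToTM2.trNat (2 ^ m) =
      List.replicate m PartrecToTM2.Γ'.bit0 ++ [PartrecToTM2.Γ'.bit1] := by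
  rw [PartrecToTM2.trNat, natCast_two_pow_num, PartrecToTM2.trNum]
  induction m with
  | zero => rfl
  | succ m ih =>
    rw [Function.iterate_succ_apply', PartrecToTM2.trPosNum, ih, List.replicate_succ,
      List.cons_append]

/-- The halting problem restricted to powers of two, for some fixed partial recursive function. -/
lemma exists_partrec_halting_two_pow :
    ∃ f : ℕ →. ℕ, Partrec f ∧ ¬ ComputablePred fun m : ℕ => (f (2 ^ m)).Dom := by
  have hpow : Computable fun m : ℕ => 2 ^ m := by
    have : Primrec fun m : ℕ => Nat.rec (motive := fun _ => ℕ) 1 (fun _ r => r + r) m :=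
      Primrec.nat_rec₁ 1 (Primrec.nat_add.comp Primrec.snd Primrec.snd)
    refine this.to_comp.of_eq fun m => ?_
    induction m with
    | zero => rfl
    | succ m ih => rw [pow_succ, ← ih]; ring
  have hle : Computable₂ fun (n m : ℕ) => decide (n ≤ 2 ^ m) :=
    (Primrec.nat_le.decide.to_comp).comp₂ (Computable.fst) (hpow.comp Computable.snd).to₂
  have hlog : Partrec fun n : ℕ => Nat.rfind fun m => Part.some (decide (n ≤ 2 ^ m)) :=
    Partrec.rfind (Computable₂.partrec₂ hle)
  let g : ℕ → Part ℕ := fun c => Nat.Partrec.Code.eval (Denumerable.ofNat _ c) 0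
  have hg : Partrec g :=
    Nat.Partrec.Code.eval_part.comp (Computable.ofNat _) (Computable.const 0)
  let log : ℕ → Part ℕ := fun n => Nat.rfind fun m => Part.some (decide (n ≤ 2 ^ m))
  -- The search for the least `m` with `n ≤ 2 ^ m` inverts `k ↦ 2 ^ k`, so on input `2 ^ k` the
  -- function runs program number `k` on `0`.
  refine ⟨fun n => (log n).bind g, hlog.bind (hg.comp Computable.snd).to₂, fun h => ?_⟩
  have hfind : ∀ k : ℕ, log (2 ^ k) = Part.some k := by
    intro k
    refine Part.eq_some_iff.2 (Nat.mem_rfind.2 ⟨?_, fun {m} hm => ?_⟩)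
    · simp
    · simpa using Nat.pow_lt_pow_right (by norm_num) hm
  refine ComputablePred.halting_problem 0 ?_
  have h' : ComputablePred fun m : ℕ => (g m).Dom := by
    refine h.of_eq fun m => ?_
    change ((log (2 ^ m)).bind g).Dom ↔ _
    rw [hfind, Part.bind_some]
  obtain ⟨f, hf, hf'⟩ := ComputablePred.computable_iff.1 h'
  refine ComputablePred.computable_iff.2 ⟨fun c => f (Encodable.encode c),
    hf.comp Computable.encode, ?_⟩
  funext c
  rw [← congrFun hf' (Encodable.encode c)]
  simp [g]

instance : Fintype PartrecToTM2.K' :=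
  ⟨{.main, .rev, .aux, .stack}, fun x => by cases x <;> simp⟩

/-- Restricting a machine to a finite supporting set of states does not affect halting. -/
lemma exists_finite_TM0 {Γ Λ : Type} [Inhabited Γ] [Inhabited Λ] (M : TM0.Machine Γ Λ)
    (S : Finset Λ) (hS : TM0.Supports M (S : Set Λ)) :
    ∃ (Λ' : Type) (_ : Inhabited Λ') (_ : Fintype Λ') (M' : TM0.Machine Γ Λ'),
      ∀ l, (TM0.eval M' l).Dom ↔ (TM0.eval M l).Dom := by
  classical
  let d : S := ⟨default, hS.1⟩
  let _ : Inhabited S := ⟨d⟩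
  let g₁ : PointedMap Λ S := ⟨fun q => if h : q ∈ S then ⟨q, h⟩ else d, by
    have : (default : Λ) ∈ S := hS.1
    simp only [this, dif_pos]; rfl⟩
  let i : PointedMap Γ Γ := ⟨id, rfl⟩
  refine ⟨S, inferInstance, inferInstance, M.map i i g₁ Subtype.val, fun l => ?_⟩
  have key := M.map_respects i i g₁ (Subtype.val : S → Λ) hS (fun _ => rfl) (fun q hq => by
    change ((if h : q ∈ S then (⟨q, h⟩ : S) else d : S) : Λ) = q
    rw [dif_pos (by exact hq)])
  have h0 := StateTransition.tr_eval_dom key (a₁ := TM0.init l) (a₂ := TM0.init l)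
    ⟨hS.1, by
      rw [TM0.map_init]
      congr 1
      exact List.map_id l⟩
  exact h0

/-- A fixed Turing machine with finitely many symbols and states whose halting problem is
undecidable already for inputs of the form `c₀ c₁ c₂ᵐ`. -/
theorem exists_undecidable_TM0 :
    ∃ (Γ Λ : Type) (_ : Inhabited Γ) (_ : Fintype Γ) (_ : Inhabited Λ) (_ : Fintype Λ)
      (M : TM0.Machine Γ Λ) (c₀ c₁ c₂ : Γ),
      ¬ ComputablePred fun m : ℕ => (TM0.eval M (c₀ :: c₁ :: List.replicate m c₂)).Dom := by
  obtain ⟨f, hf, hund⟩ := exists_partrec_halting_two_pow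
  obtain ⟨c, hc⟩ := ToPartrec.Code.exists_code (Nat.Partrec'.part_iff₁.2 hf)
  -- Machines start in the default state, so this has to be the entry point of the code `c`.
  let _ : Inhabited PartrecToTM2.Λ' := ⟨PartrecToTM2.trNormal c .halt⟩
  have s2 := PartrecToTM2.tr_supports c .halt
  have s1 := TM2to1.tr_supports PartrecToTM2.tr s2
  have s0 := TM1to0.tr_supports (TM2to1.tr PartrecToTM2.tr) s1
  obtain ⟨Λ', i1, i2, M', hM'⟩ := exists_finite_TM0 _ _ s0
  -- A tape symbol of the simulation holds one entry per stack and a flag for the stack bottom. The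
  -- main stack lies on the tape bottom first, so the digits follow `cons` in reverse order.
  let e : Bool → PartrecToTM2.Γ' → TM2to1.Γ' PartrecToTM2.K' fun _ => PartrecToTM2.Γ' :=
    fun b a => (b, Function.update (fun _ => none) .main (some a))
  refine ⟨TM2to1.Γ' PartrecToTM2.K' fun _ => PartrecToTM2.Γ', Λ', inferInstance, inferInstance,
    i1, i2, M', e true .cons, e false .bit1, e false .bit0, fun h => hund ?_⟩
  refine h.of_eq fun m => ?_
  have hin : e true .cons :: e false .bit1 :: List.replicate m (e false .bit0) =
      TM2to1.trInit PartrecToTM2.K'.main (PartrecToTM2.trList [2 ^ m]) := by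
    simp only [TM2to1.trInit, PartrecToTM2.trList, trNat_two_pow, List.reverse_append,
      List.reverse_cons, List.reverse_nil, List.reverse_replicate, List.nil_append,
      List.cons_append]
    rw [← List.map_replicate]
    rfl
  rw [hin]
  refine (hM' _).trans ?_
  rw [TM1to0.tr_eval]
  refine (TM2to1.tr_eval_dom _ _ _).trans ?_
  have h2 := PartrecToTM2.tr_eval c [2 ^ m]
  have h3 := hc ⟨[2 ^ m], rfl⟩
  have hinit : PartrecToTM2.init c [2 ^ m] =
      TM2.init PartrecToTM2.K'.main (PartrecToTM2.trList [2 ^ m]) := by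
    unfold PartrecToTM2.init TM2.init
    congr 1
    funext k
    cases k <;> rfl
  rw [hinit] at h2
  change (Part.map _ (StateTransition.eval _ _)).Dom ↔ _
  rw [h2]
  simp only [List.Vector.head] at h3
  change (ToPartrec.Code.eval c [2 ^ m]).Dom ↔ _
  rw [h3]
  rfl

end Universal

/-! ### Turing machines as cellular automata on a helix -/

open Turing

section Cellular

variable {Γ Λ : Type} [Inhabited Λ]

/-- A cell is a border marker (`none`), or a tape symbol together with the state of the machine if
the head is there. -/
abbrev Cell (Γ Λ : Type) := Option (Γ × Option Λ)

/-- The state that leaves a cell in direction `d`. -/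
def emits (M : TM0.Machine Γ Λ) (d : Dir) : Cell Γ Λ → Option Λ
  | some (γ, some q) =>
    match M q γ with
    | some (q', .move d') => if d = d' then some q' else none
    | _ => none
  | _ => none

/-- The new content of a cell as a function of its neighbourhood. Halted cells are frozen. -/
def localRule (M : TM0.Machine Γ Λ) (a b c : Cell Γ Λ) : Cell Γ Λ :=
  match b with
  | none => none
  | some (γ, none) => some (γ, (emits M .right a).or (emits M .left c))
  | some (γ, some q) =>
    match M q γ with
    | none => some (γ, some q)
    | some (q', .write γ') => some (γ', some q')
    | some (_, .move _) => some (γ, none)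

/-- A cell in which the machine has halted. -/
def IsHalted (M : TM0.Machine Γ Λ) (c : Cell Γ Λ) : Prop :=
  ∃ γ q, c = some (γ, some q) ∧ M q γ = none

lemma emits_of_no_head (M : TM0.Machine Γ Λ) (d : Dir) (γ : Γ) :
    emits M d (some (γ, none)) = none :=
  rfl

lemma emits_marker (M : TM0.Machine Γ Λ) (d : Dir) : emits M d (none : Cell Γ Λ) = none :=
  rfl

/-- A sequence that starts with two markers and `C` given cells, and in which each further cell is
determined by three consecutive cells read `C` places earlier. -/
structure IsHelix {S : Type} (F : S → S → S → S) (marker : S) (C : ℕ) (w : ℕ → S)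
    (y : ℕ → S) : Prop where
  zero : y 0 = marker
  one : y 1 = marker
  init : ∀ r < C, y (r + 2) = w r
  next : ∀ i, y (i + C + 2) = F (y i) (y (i + 1)) (y (i + 2))

/-- Strong recursion works because `0 < C` puts all three arguments of `F` at earlier positions. -/
lemma exists_isHelix {S : Type} (F : S → S → S → S) (marker : S) {C : ℕ} (hC : 0 < C)
    (w : ℕ → S) : ∃ y, IsHelix F marker C w y := by
  let step : (n : ℕ) → ((m : ℕ) → m < n → S) → S := fun n ih =>
    if n < 2 then marker else
    if h : n < C + 2 then w (n - 2) else
      F (ih (n - C - 2) (by omega)) (ih (n - C - 2 + 1) (by omega))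
        (ih (n - C - 2 + 2) (by omega))
  let y : ℕ → S := fun n => Nat.strongRec step n
  have hy : ∀ n, y n = step n fun m _ => y m := fun n => Nat.strongRec_eq step n
  refine ⟨y, ?_, ?_, fun r hr => ?_, fun i => ?_⟩
  · rw [hy]; simp [step]
  · rw [hy]; simp [step]
  · rw [hy]; simp [step, hr]
  · rw [hy]
    have h1 : ¬ i + C + 2 < 2 := by omega
    have h3 : i + C + 2 - C - 2 = i := by omega
    simp only [step, h3, if_neg h1]
    rw [dif_neg (by omega)]

variable {M : TM0.Machine Γ Λ} {C : ℕ} {w y : ℕ → Cell Γ Λ}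

/-- The middle argument of the rule lies `C + 1` places before the cell it determines, and
`localRule` preserves markers. So the helix consists of rows of `C` cells, and the marker after a
row is also the one before the next row. -/
lemma helix_marker (hy : IsHelix (localRule M) none C w y) (k : ℕ) :
    y (k * (C + 1) + 1) = none := by
  induction k with
  | zero => simpa using hy.one
  | succ k ih =>
    have := hy.next (k * (C + 1))
    rw [ih] at this
    rw [show (k + 1) * (C + 1) + 1 = k * (C + 1) + C + 2 by ring, this]
    rfl

lemma helix_cell_succ (hy : IsHelix (localRule M) none C w y) (k r : ℕ) :
    y ((k + 1) * (C + 1) + 2 + r) =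
      localRule M (y (k * (C + 1) + 1 + r)) (y (k * (C + 1) + 2 + r))
        (y (k * (C + 1) + 3 + r)) := by
  have := hy.next (k * (C + 1) + 1 + r)
  rw [show (k + 1) * (C + 1) + 2 + r = k * (C + 1) + 1 + r + C + 2 by ring, this]
  congr 2 <;> ring

lemma helix_border (hy : IsHelix (localRule M) none C w y) (k : ℕ) :
    y (k * (C + 1) + 2 + C) = none := by
  have := helix_marker hy (k + 1)
  rwa [show (k + 1) * (C + 1) + 1 = k * (C + 1) + 2 + C by ring] at this

/-- A cell without a head. -/
def Headless (c : Cell Γ Λ) : Prop := ∀ γ q, c ≠ some (γ, some q)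

lemma Headless.emits {c : Cell Γ Λ} (hc : Headless c) (d : Dir) : emits M d c = none := by
  rcases c with _ | ⟨γ, _ | q⟩
  · rfl
  · rfl
  · exact absurd rfl (hc γ q)

lemma headless_localRule {a b c : Cell Γ Λ} (ha : Headless a) (hb : Headless b)
    (hc : Headless c) : Headless (localRule M a b c) := by
  rcases b with _ | ⟨γ, _ | q⟩
  · intro γ q h
    simp [localRule] at h
  · intro γ q h
    simp [localRule, ha.emits, hc.emits] at h
  · exact absurd rfl (hb γ q)

/-- Once the head has run into a marker, it never comes back. -/
lemma helix_dead (hy : IsHelix (localRule M) none C w y) {k : ℕ}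
    (hk : ∀ r < C, Headless (y (k * (C + 1) + 2 + r))) {n : ℕ} (hn : k ≤ n) :
    ∀ r < C, Headless (y (n * (C + 1) + 2 + r)) := by
  induction n, hn using Nat.le_induction with
  | base => exact hk
  | succ n _ ih =>
    intro r hr
    rw [helix_cell_succ hy]
    have hnone : Headless (none : Cell Γ Λ) := fun γ q h => by cases h
    refine headless_localRule ?_ (ih r hr) ?_
    · rcases Nat.eq_zero_or_pos r with rfl | hr0
      · simpa [helix_marker hy n] using hnone
      · have := ih (r - 1) (by omega)
        rwa [show n * (C + 1) + 2 + (r - 1) = n * (C + 1) + 1 + r by omega] at this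
    · rcases Nat.lt_or_ge (r + 1) C with hr1 | hr1
      · have := ih (r + 1) hr1
        rwa [show n * (C + 1) + 2 + (r + 1) = n * (C + 1) + 3 + r by omega] at this
      · rw [show n * (C + 1) + 3 + r = n * (C + 1) + 2 + C by omega, helix_border hy n]
        exact hnone

/-! ### The run of the machine, in absolute head positions, compared with the helix. -/

variable [Inhabited Γ]

/-- The cell at absolute position `z` when the head is at absolute position `h`. -/
def cellAt (c : TM0.Cfg Γ Λ) (h z : ℤ) : Cell Γ Λ :=
  some (c.Tape.nth (z - h), if z = h then some c.q else none)

/-- The displacement of the head in the next step. -/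
def headMove (M : TM0.Machine Γ Λ) (c : TM0.Cfg Γ Λ) : ℤ :=
  match M c.q c.Tape.head with
  | some (_, .move .left) => -1
  | some (_, .move .right) => 1
  | _ => 0

/-- One step of the machine, with halted configurations frozen and the head position tracked. -/
def headStep (M : TM0.Machine Γ Λ) (p : TM0.Cfg Γ Λ × ℤ) : TM0.Cfg Γ Λ × ℤ :=
  ((TM0.step M p.1).getD p.1, p.2 + headMove M p.1)

lemma emits_cellAt_of_ne (M : TM0.Machine Γ Λ) (d : Dir) (c : TM0.Cfg Γ Λ) {h z : ℤ} (hz : z ≠ h) :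
    emits M d (cellAt c h z) = none := by
  simp only [cellAt, if_neg hz, emits_of_no_head]

lemma emits_cellAt_self (M : TM0.Machine Γ Λ) (d : Dir) (c : TM0.Cfg Γ Λ) (h : ℤ) :
    emits M d (cellAt c h h) =
      match M c.q c.Tape.head with
      | some (q', .move d') => if d = d' then some q' else none
      | _ => none := by
  simp [cellAt, emits]

lemma headMove_bounds (M : TM0.Machine Γ Λ) (c : TM0.Cfg Γ Λ) :
    -1 ≤ headMove M c ∧ headMove M c ≤ 1 := by
  unfold headMove
  split <;> constructor <;> norm_num

/-- A neighbour matters only through the state it emits, and only the cell under the head emits. So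
a marker may stand in for a neighbour without head, as happens at the borders of the window. -/
lemma localRule_cellAt (M : TM0.Machine Γ Λ) (c : TM0.Cfg Γ Λ) (h z : ℤ) (a b : Cell Γ Λ)
    (ha : a = cellAt c h (z - 1) ∨ a = none ∧ z - 1 ≠ h)
    (hb : b = cellAt c h (z + 1) ∨ b = none ∧ z + 1 ≠ h) :
    localRule M a (cellAt c h z) b =
      cellAt (headStep M (c, h)).1 (headStep M (c, h)).2 z := by
  have ha' : emits M .right a = emits M .right (cellAt c h (z - 1)) := by
    rcases ha with rfl | ⟨rfl, ha⟩
    · rfl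
    · rw [emits_cellAt_of_ne M _ c ha, emits_marker]
  have hb' : emits M .left b = emits M .left (cellAt c h (z + 1)) := by
    rcases hb with rfl | ⟨rfl, hb⟩
    · rfl
    · rw [emits_cellAt_of_ne M _ c hb, emits_marker]
  obtain ⟨q, T⟩ := c
  by_cases hz : z = h
  · subst hz
    rcases hM : M q T.head with _ | ⟨q', (_ | _) | γ'⟩ <;>
      simp [cellAt, localRule, headStep, headMove, TM0.step, hM, Tape.write]
  · have hl : localRule M a (cellAt ⟨q, T⟩ h z) b = some (T.nth (z - h),
        (emits M .right (cellAt ⟨q, T⟩ h (z - 1))).or (emits M .left (cellAt ⟨q, T⟩ h (z + 1)))) := by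
      rw [← ha', ← hb']
      simp only [cellAt, if_neg hz, localRule]
    rw [hl]
    by_cases h1 : z = h + 1
    · subst h1
      have e1 : (T.move .right).head = T.nth 1 := by
        rw [← Tape.nth_zero, Tape.move_right_nth, zero_add]
      rw [add_sub_cancel_right, emits_cellAt_self, emits_cellAt_of_ne M _ _ (by omega)]
      rcases hM : M q T.head with _ | ⟨q', (_ | _) | γ'⟩ <;>
        simp [cellAt, headStep, headMove, TM0.step, hM, e1]
    · rw [emits_cellAt_of_ne M _ _ (show z - 1 ≠ h by omega)]
      by_cases h2 : z + 1 = h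
      · obtain rfl : z = h - 1 := by omega
        have e1 : h - 1 - (h + 1) + 1 = -1 := by ring
        have e2 : h - 1 - (h + -1) - 1 = -1 := by ring
        have e3 : h - 1 - h = -1 := by ring
        rw [sub_add_cancel, emits_cellAt_self]
        rcases hM : M q T.head with _ | ⟨q', (_ | _) | γ'⟩ <;>
          simp [cellAt, headStep, headMove, TM0.step, hM, e1, e2, e3] <;> omega
      · have e1 : z - (h + 1) + 1 = z - h := by ring
        have e2 : z - (h + -1) - 1 = z - h := by ring
        have e3 : z ≠ h + -1 := by omega
        have e4 : z - h ≠ 0 := by omega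
        rw [emits_cellAt_of_ne M _ _ h2]
        rcases hM : M q T.head with _ | ⟨q', (_ | _) | γ'⟩ <;>
          simp [cellAt, headStep, headMove, TM0.step, hM, hz, h1, e1, e2, e3, e4]

/-- The configuration and the head position after `k` steps on input `l`. -/
def headRun (M : TM0.Machine Γ Λ) (l : List Γ) (k : ℕ) : TM0.Cfg Γ Λ × ℤ :=
  (headStep M)^[k] (TM0.init l, 0)

lemma headRun_succ (M : TM0.Machine Γ Λ) (l : List Γ) (k : ℕ) :
    headRun M l (k + 1) = headStep M (headRun M l k) :=
  Function.iterate_succ_apply' _ _ _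

lemma abs_headRun_le (M : TM0.Machine Γ Λ) (l : List Γ) (k : ℕ) :
    -(k : ℤ) ≤ (headRun M l k).2 ∧ (headRun M l k).2 ≤ k := by
  induction k with
  | zero => simp [headRun]
  | succ k ih =>
    rw [headRun_succ]
    have := headMove_bounds M (headRun M l k).1
    simp only [headStep]
    push_cast
    omega

lemma eval_dom_iff_headRun (M : TM0.Machine Γ Λ) (l : List Γ) :
    (TM0.eval M l).Dom ↔ ∃ k, TM0.step M (headRun M l k).1 = none := by
  have h1 : (TM0.eval M l).Dom ↔ (StateTransition.eval (TM0.step M) (TM0.init l)).Dom := Iff.rfl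
  rw [h1, Part.dom_iff_mem]
  simp only [StateTransition.mem_eval]
  constructor
  · rintro ⟨b, hb, hb'⟩
    have : ∃ k, (headRun M l k).1 = b := by
      clear hb'
      induction hb with
      | refl => exact ⟨0, rfl⟩
      | tail _ hbc ih =>
        obtain ⟨k, hk⟩ := ih
        refine ⟨k + 1, ?_⟩
        rw [headRun_succ, headStep, hk, Option.mem_def.1 hbc]
        rfl
    obtain ⟨k, rfl⟩ := this
    exact ⟨k, hb'⟩
  · rintro ⟨k, hk⟩
    refine ⟨_, ?_, hk⟩
    clear hk
    induction k with
    | zero => exact Relation.ReflTransGen.refl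
    | succ k ih =>
      rw [headRun_succ, headStep]
      rcases hs : TM0.step M (headRun M l k).1 with _ | c
      · exact ih
      · exact ih.tail hs

lemma headRun_eq_of_halted (M : TM0.Machine Γ Λ) (l : List Γ) {k : ℕ}
    (hk : TM0.step M (headRun M l k).1 = none) {n : ℕ} (hn : k ≤ n) :
    headRun M l n = headRun M l k := by
  induction n, hn using Nat.le_induction with
  | base => rfl
  | succ n _ ih =>
    rw [headRun_succ, ih, headStep, hk]
    have h0 : M (headRun M l k).1.q (headRun M l k).1.Tape.head = none := by
      simpa [TM0.step] using hk
    simp [headMove, h0]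

lemma isHalted_cellAt_iff (M : TM0.Machine Γ Λ) (c : TM0.Cfg Γ Λ) (h z : ℤ) :
    IsHalted M (cellAt c h z) ↔ z = h ∧ TM0.step M c = none := by
  constructor
  · rintro ⟨γ, q, hc, hM⟩
    by_cases hz : z = h
    · subst hz
      simp only [cellAt, sub_self, Tape.nth_zero, if_true, Option.some.injEq, Prod.mk.injEq] at hc
      refine ⟨rfl, ?_⟩
      simp [TM0.step, hc.1, hc.2, hM]
    · simp [cellAt, hz] at hc
  · rintro ⟨rfl, hs⟩
    exact ⟨c.Tape.head, c.q, by simp [cellAt], by simpa [TM0.step] using hs⟩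

variable {l : List Γ} {a : ℕ}

/-- As long as the head stays between the markers, the helix shows the run of the machine. -/
lemma helix_alive (hy : IsHelix (localRule M) none C w y)
    (hw : ∀ r < C, w r = cellAt (TM0.init l) 0 ((r : ℤ) - a)) (k : ℕ)
    (hk : ∀ j < k, 0 ≤ (headRun M l j).2 + a ∧ (headRun M l j).2 + a < C) :
    ∀ r < C, y (k * (C + 1) + 2 + r) =
      cellAt (headRun M l k).1 (headRun M l k).2 ((r : ℤ) - a) := by
  induction k with
  | zero =>
    intro r hr
    have := hy.init r hr
    rw [show 0 * (C + 1) + 2 + r = r + 2 by ring, this, hw r hr]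
    rfl
  | succ k ih =>
    intro r hr
    have ih := ih fun j hj => hk j (by omega)
    have hb := hk k (by omega)
    rw [helix_cell_succ hy, ih r hr, headRun_succ]
    refine localRule_cellAt M _ _ _ _ _ ?_ ?_
    · rcases Nat.eq_zero_or_pos r with rfl | hr0
      · right
        exact ⟨helix_marker hy k, by push_cast; omega⟩
      · left
        have := ih (r - 1) (by omega)
        rw [show k * (C + 1) + 2 + (r - 1) = k * (C + 1) + 1 + r by omega] at this
        rw [this]
        congr 1
        omega
    · rcases Nat.lt_or_ge (r + 1) C with hr1 | hr1
      · left
        have := ih (r + 1) hr1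
        rw [show k * (C + 1) + 2 + (r + 1) = k * (C + 1) + 3 + r by omega] at this
        rw [this]
        congr 1
        push_cast
        ring
      · right
        have := helix_border hy k
        rw [show k * (C + 1) + 2 + C = k * (C + 1) + 3 + r by omega] at this
        exact ⟨this, by omega⟩

/-- A halted cell on the helix comes from a halting run. -/
theorem eval_dom_of_helix (hy : IsHelix (localRule M) none C w y)
    (hw : ∀ r < C, w r = cellAt (TM0.init l) 0 ((r : ℤ) - a)) {n : ℕ}
    (hn : IsHalted M (y n)) : (TM0.eval M l).Dom := by
  rw [eval_dom_iff_headRun]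
  have hnone : ¬ IsHalted M none := by rintro ⟨γ, q, h, -⟩; cases h
  rcases n with _ | n
  · rw [hy.zero] at hn
    exact absurd hn hnone
  -- Position `n + 1` is the marker before row `k` if `s = 0`, and cell `r` of row `k` if `s = r +
  -- 1`.
  obtain ⟨k, s, hs, rfl⟩ : ∃ k s, s < C + 1 ∧ n = k * (C + 1) + s :=
    ⟨n / (C + 1), n % (C + 1), Nat.mod_lt _ (by omega), (Nat.div_add_mod' _ _).symm⟩
  rcases s with _ | r
  · rw [add_zero, helix_marker hy] at hn
    exact absurd hn hnone
  rw [show k * (C + 1) + (r + 1) + 1 = k * (C + 1) + 2 + r by ring] at hn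
  by_cases hk : ∀ j < k, 0 ≤ (headRun M l j).2 + a ∧ (headRun M l j).2 + a < C
  · rw [helix_alive hy hw k hk r (by omega), isHalted_cellAt_iff] at hn
    exact ⟨k, hn.2⟩
  · exfalso
    classical
    push Not at hk
    have hk' : ∃ j, j < k ∧ ¬ (0 ≤ (headRun M l j).2 + a ∧ (headRun M l j).2 + a < C) := by
      obtain ⟨j, hj, h⟩ := hk
      exact ⟨j, hj, fun h' => absurd (h h'.1) (not_le.2 h'.2)⟩
    -- At the first time at which the head is outside the window, the row still shows the true
    -- configuration and therefore no head. Then no later row has one.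
    have hj := Nat.find_spec hk'
    have hmin : ∀ i < Nat.find hk', 0 ≤ (headRun M l i).2 + a ∧ (headRun M l i).2 + a < C := by
      intro i hi
      by_contra hcon
      exact Nat.find_min hk' hi ⟨lt_trans hi hj.1, hcon⟩
    set j := Nat.find hk'
    have halive := helix_alive hy hw j hmin
    have hdead := helix_dead hy (k := j) (fun r hr γ q h => by
      rw [halive r hr, cellAt] at h
      rw [if_neg (by omega)] at h
      simp at h) hj.1.le r (by omega)
    obtain ⟨γ, q, h, -⟩ := hn
    exact hdead γ q h

/-- A halting run shows up on every helix with enough blank cells around the input. -/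
theorem exists_isHalted_helix (h : (TM0.eval M l).Dom) :
    ∃ T : ℕ, ∀ C w y, 2 * T < C → IsHelix (localRule M) none C w y →
      (∀ r < C, w r = cellAt (TM0.init l) 0 ((r : ℤ) - T)) →
      ∃ p, C < p ∧ IsHalted M (y (p + 2)) := by
  obtain ⟨T, hT⟩ := (eval_dom_iff_headRun M l).1 h
  refine ⟨T, fun C w y hC hy hw => ?_⟩
  have hb : ∀ j, -(T : ℤ) ≤ (headRun M l j).2 ∧ (headRun M l j).2 ≤ T := by
    intro j
    rcases le_total j T with hj | hj
    · have := abs_headRun_le M l j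
      omega
    · rw [headRun_eq_of_halted M l hT hj]
      exact abs_headRun_le M l T
  obtain ⟨r, hr⟩ : ∃ r : ℕ, (r : ℤ) = (headRun M l T).2 + T :=
    ⟨((headRun M l T).2 + T).toNat, Int.toNat_of_nonneg (by have := hb T; omega)⟩
  -- Row `T + 1` repeats the halted row `T`. It is used instead so that the halted cell lies beyond
  -- the first `C` cells even when `T = 0`.
  have halive := helix_alive hy hw (T + 1) (fun j _ => by have := hb j; omega) r
    (by have := hb T; omega)
  rw [headRun_eq_of_halted M l hT (Nat.le_succ T)] at halive
  refine ⟨(T + 1) * (C + 1) + r, ?_, ?_⟩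
  · nlinarith
  · rw [show (T + 1) * (C + 1) + r + 2 = (T + 1) * (C + 1) + 2 + r by ring, halive,
      isHalted_cellAt_iff]
    exact ⟨by omega, hT⟩

end Cellular

/-! ### Acceptance -/

section Acceptance

/-- Languages speak of time stamps and runs of delays; injectivity allows all later arguments to use
delays alone. -/
lemma stamp_injective : ∀ (t : ℝ≥0) (ρ ρ' : List (ℕ × ℝ≥0)), stamp t ρ = stamp t ρ' → ρ = ρ'
  | _, [], [], _ => rfl
  | _, [], (_, _) :: _, h => by simp [stamp] at h
  | _, (_, _) :: _, [], h => by simp [stamp] at h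
  | t, (a, δ) :: ρ, (a', δ') :: ρ', h => by
    simp only [stamp, List.cons.injEq, Prod.mk.injEq, add_right_inj] at h
    obtain ⟨⟨rfl, rfl⟩, h⟩ := h
    rw [stamp_injective _ ρ ρ' h]

lemma le_of_mem_stamp : ∀ (t : ℝ≥0) (ρ : List (ℕ × ℝ≥0)), ∀ x ∈ (stamp t ρ).map Prod.snd, t ≤ x
  | _, [], x, hx => by simp [stamp] at hx
  | t, (a, δ) :: ρ, x, hx => by
    simp only [stamp, List.map_cons, List.mem_cons] at hx
    rcases hx with rfl | hx
    · exact le_self_add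
    · exact le_self_add.trans (le_of_mem_stamp (t + δ) ρ x hx)

lemma pairwise_stamp : ∀ (t : ℝ≥0) (ρ : List (ℕ × ℝ≥0)),
    ((stamp t ρ).map Prod.snd).Pairwise (· ≤ ·)
  | _, [] => by simp [stamp]
  | t, (a, δ) :: ρ => by
    simp only [stamp, List.map_cons, List.pairwise_cons]
    exact ⟨le_of_mem_stamp _ ρ, pairwise_stamp _ ρ⟩

lemma map_fst_stamp : ∀ (t : ℝ≥0) (ρ : List (ℕ × ℝ≥0)),
    (stamp t ρ).map Prod.fst = ρ.map Prod.fst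
  | _, [] => rfl
  | t, (a, δ) :: ρ => by simp [stamp, map_fst_stamp (t + δ) ρ]

namespace TPDA

/-- Some run from `s` over `ρ` ends in an accepting location. -/
def AcceptsFrom (A : TPDA) (s : State) (ρ : List (ℕ × ℝ≥0)) : Prop :=
  ∃ s', A.Run s ρ s' ∧ s'.loc ∈ A.final

/-- Some accepting run over `ρ` starts in an initial state. -/
def Accepts (A : TPDA) (ρ : List (ℕ × ℝ≥0)) : Prop :=
  ∃ s : State, s.loc ∈ A.init ∧ (∀ x ∈ A.clocks, s.val x = 0) ∧ s.stk = [] ∧ A.AcceptsFrom s ρ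

lemma acceptsFrom_nil {A : TPDA} {s : State} : A.AcceptsFrom s [] ↔ s.loc ∈ A.final := by
  constructor
  · rintro ⟨s', ⟨⟩, h⟩
    exact h
  · exact fun h => ⟨s, .nil s, h⟩

lemma acceptsFrom_cons {A : TPDA} {s : State} {a : ℕ} {δ : ℝ≥0} {ρ : List (ℕ × ℝ≥0)} :
    A.AcceptsFrom s ((a, δ) :: ρ) ↔ ∃ s', A.Step s δ a s' ∧ A.AcceptsFrom s' ρ := by
  constructor
  · rintro ⟨s', _ | ⟨h, h'⟩, hf⟩
    exact ⟨_, h, _, h', hf⟩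
  · rintro ⟨s', h, s'', h', hf⟩
    exact ⟨s'', .cons h h', hf⟩

lemma Run.mem_alphabet {A : TPDA} (hA : A.WellFormed) {s s' : State} {ρ : List (ℕ × ℝ≥0)}
    (h : A.Run s ρ s') : ∀ a ∈ ρ.map Prod.fst, a ∈ A.alphabet := by
  induction h with
  | nil => simp
  | cons hstep _ ih =>
    obtain ⟨e, he, -, rfl, -⟩ := hstep
    simp only [List.map_cons, List.mem_cons, forall_eq_or_imp]
    exact ⟨hA.sym_mem e he, ih⟩

lemma stamp_mem_language_iff {A : TPDA} {ρ : List (ℕ × ℝ≥0)} :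
    stamp 0 ρ ∈ A.language ↔
      (ρ ≠ [] ∧ ∀ a ∈ ρ.map Prod.fst, a ∈ A.alphabet) ∧ A.Accepts ρ := by
  have h1 : stamp 0 ρ ∈ TimedWords A.alphabet ↔
      ρ ≠ [] ∧ ∀ a ∈ ρ.map Prod.fst, a ∈ A.alphabet := by
    rw [← map_fst_stamp 0 ρ]
    have h0 : stamp 0 ρ ≠ [] ↔ ρ ≠ [] := by
      rcases ρ with _ | ⟨⟨a, δ⟩, ρ⟩ <;> simp [stamp]
    simp only [TimedWords, Set.mem_ofPred_eq, h0, pairwise_stamp, and_true,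
      List.forall_mem_map]
  rw [language, Set.mem_sep_iff, h1]
  refine and_congr_right fun _ => ⟨?_, ?_⟩
  · rintro ⟨s, s', ρ', h1, h2, h3, h4, h5, h6⟩
    cases stamp_injective _ _ _ h6
    exact ⟨s, h1, h2, h3, s', h4, h5⟩
  · rintro ⟨s, h1, h2, h3, s', h4, h5⟩
    exact ⟨s, s', ρ, h1, h2, h3, h4, h5, rfl⟩

lemma language_subset_iff {A B : TPDA} (hA : A.WellFormed) (hAB : A.SameAlphabet B) :
    A.language ⊆ B.language ↔ ∀ ρ, ρ ≠ [] → A.Accepts ρ → B.Accepts ρ := by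
  constructor
  · intro h ρ hρ hacc
    have hmem : stamp 0 ρ ∈ A.language := by
      refine stamp_mem_language_iff.2 ⟨⟨hρ, ?_⟩, hacc⟩
      obtain ⟨s, -, -, -, s', hrun, -⟩ := hacc
      exact hrun.mem_alphabet hA
    exact (stamp_mem_language_iff.1 (h hmem)).2
  · intro h w hw
    obtain ⟨-, s, s', ρ, h1, h2, h3, h4, h5, rfl⟩ := id hw
    obtain ⟨⟨hρ, hal⟩, hacc⟩ := stamp_mem_language_iff.1 hw
    exact stamp_mem_language_iff.2 ⟨⟨hρ, fun a ha => (hAB a).1 (hal a ha)⟩, h ρ hρ hacc⟩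

end TPDA

end Acceptance

/-! ### Words over cells -/

/-- The three kinds of input symbols. -/
inductive Phase where
  | int | call | ret
  deriving DecidableEq, Encodable

instance : Fintype Phase := ⟨{.int, .call, .ret}, fun x => by cases x <;> simp⟩

section Words

variable {S : Type} [Encodable S]

/-- The word of the events `k, …, k + n - 1`, where event `i` has phase `p i`, cell `y (i + 2)` and
delay `d i`. -/
def cellWord (p : ℕ → Phase) (y : ℕ → S) (d : ℕ → ℝ≥0) (k n : ℕ) : List (ℕ × ℝ≥0) :=
  (List.range' k n).map fun i => (Encodable.encode (p i, y (i + 2)), d i)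

lemma cellWord_zero (p : ℕ → Phase) (y : ℕ → S) (d : ℕ → ℝ≥0) (k : ℕ) :
    cellWord p y d k 0 = [] := rfl

lemma cellWord_succ (p : ℕ → Phase) (y : ℕ → S) (d : ℕ → ℝ≥0) (k n : ℕ) :
    cellWord p y d k (n + 1) =
      (Encodable.encode (p k, y (k + 2)), d k) :: cellWord p y d (k + 1) n := by
  simp [cellWord, List.range'_succ]

/-- The two markers precede the first event, which explains the shift in `y (i + 2)`. Values beyond
the end of the word are irrelevant. -/
lemma exists_eq_cellWord (marker : S) (ρ : List (ℕ × ℝ≥0))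
    (h : ∀ a ∈ ρ.map Prod.fst, ∃ σ : Phase × S, Encodable.encode σ = a) :
    ∃ p y d, y 0 = marker ∧ y 1 = marker ∧ ρ = cellWord p (y : ℕ → S) d 0 ρ.length := by
  have h' : ∀ i : ℕ, ∃ t : Phase × S, ∀ hi : i < ρ.length, Encodable.encode t = ρ[i].1 := by
    intro i
    by_cases hi : i < ρ.length
    · obtain ⟨σ, hσ⟩ := h ρ[i].1 (List.mem_map_of_mem (List.getElem_mem hi))
      exact ⟨σ, fun _ => hσ⟩
    · exact ⟨(.int, marker), fun hi' => absurd hi' hi⟩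
  choose t ht using h'
  refine ⟨fun i => (t i).1, fun i => if i < 2 then marker else (t (i - 2)).2,
    fun i => if hi : i < ρ.length then ρ[i].2 else 0, by simp, by simp, ?_⟩
  refine List.ext_getElem (by simp [cellWord]) fun i h1 h2 => ?_
  simp [cellWord, ht i h1, h1]

end Words

/-! ### The timed automaton that accepts the faulty words -/

section Faults

variable (S : Type)

/-- Locations: `track a b` remembers the last two cells, `await s` waits for a cell `s` one time
unit after the last reset, `tie` expects an event without delay, and `done` accepts. -/
inductive FaultLoc where
  | track (a b : S)
  | await (s : S)
  | tie
  | done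
  deriving Fintype, Encodable

variable {S}

/-- The edges of the automaton, which has the single clock `0`. -/
inductive FaultEdge (F : S → S → S → S) :
    FaultLoc S → Phase × S → Guard → List ℕ → FaultLoc S → Prop
  | track (a b : S) (p : Phase) (c : S) : FaultEdge F (.track a b) (p, c) [] [] (.track b c)
  | guess (a b : S) (p : Phase) (c : S) : p ≠ .ret →
      FaultEdge F (.track a b) (p, c) [] [0] (.await (F a b c))
  | tie (a b : S) (σ : Phase × S) : FaultEdge F (.track a b) σ [] [0] .tie
  | tied (σ : Phase × S) : FaultEdge F .tie σ [⟨0, .eq, 0⟩] [] .done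
  | done (σ : Phase × S) : FaultEdge F .done σ [] [] .done
  | before (s : S) (σ : Phase × S) : FaultEdge F (.await s) σ [⟨0, .lt, 1⟩] [] (.await s)
  | after (s : S) (σ : Phase × S) : FaultEdge F (.await s) σ [⟨0, .gt, 1⟩] [] (.await s)
  | wrong (s : S) (p : Phase) (c : S) : ¬ (p ≠ .call ∧ c = s) →
      FaultEdge F (.await s) (p, c) [⟨0, .eq, 1⟩] [] (.await s)

variable [Fintype S] [Encodable S]

/-- The edges of the automaton, as edges between numbers. -/
def faultEdges (F : S → S → S → S) : Set Edge :=
  {e | ∃ l σ g r l', FaultEdge F l σ g r l' ∧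
    e = ⟨Encodable.encode l, Encodable.encode σ, g, .noop, r, Encodable.encode l'⟩}

/-- Guards and resets range over infinite types, but only five guards and two reset lists occur. -/
lemma faultEdges_finite (F : S → S → S → S) : (faultEdges F).Finite := by
  classical
  let gs : Finset (Option (Cmp × ℕ)) :=
    {none, some (.eq, 0), some (.lt, 1), some (.gt, 1), some (.eq, 1)}
  let f : FaultLoc S × (Phase × S) × gs × Bool × FaultLoc S → Edge := fun t =>
    ⟨Encodable.encode t.1, Encodable.encode t.2.1,
      match t.2.2.1.1 with
      | none => []
      | some (r, c) => [⟨0, r, c⟩],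
      .noop, if t.2.2.2.1 then [0] else [], Encodable.encode t.2.2.2.2⟩
  refine (Set.finite_range f).subset ?_
  rintro _ ⟨l, σ, g, r, l', h, rfl⟩
  cases h
  · exact ⟨(_, _, ⟨none, by simp [gs]⟩, false, _), rfl⟩
  · exact ⟨(_, _, ⟨none, by simp [gs]⟩, true, _), rfl⟩
  · exact ⟨(_, _, ⟨none, by simp [gs]⟩, true, _), rfl⟩
  · exact ⟨(_, _, ⟨some (.eq, 0), by simp [gs]⟩, false, _), rfl⟩
  · exact ⟨(_, _, ⟨none, by simp [gs]⟩, false, _), rfl⟩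
  · exact ⟨(_, _, ⟨some (.lt, 1), by simp [gs]⟩, false, _), rfl⟩
  · exact ⟨(_, _, ⟨some (.gt, 1), by simp [gs]⟩, false, _), rfl⟩
  · exact ⟨(_, _, ⟨some (.eq, 1), by simp [gs]⟩, false, _), rfl⟩

/-- The automaton that accepts the words with two simultaneous consecutive events, and those in
which the prescribed successor of some event is missing. -/
noncomputable def faultAutomaton (F : S → S → S → S) (marker : S) : TPDA where
  alphabet := (Finset.univ : Finset (Phase × S)).toList.map Encodable.encode
  stack := []
  locs := (Finset.univ : Finset (FaultLoc S)).toList.map Encodable.encode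
  init := [Encodable.encode (FaultLoc.track marker marker)]
  final := Encodable.encode (FaultLoc.done : FaultLoc S) ::
    (Finset.univ : Finset S).toList.map fun s => Encodable.encode (FaultLoc.await s)
  clocks := [0]
  edges := (faultEdges_finite F).toFinset.toList

variable {F : S → S → S → S} {marker : S}

lemma mem_edges_faultAutomaton {e : Edge} :
    e ∈ (faultAutomaton F marker).edges ↔ ∃ l σ g r l', FaultEdge F l σ g r l' ∧
      e = ⟨Encodable.encode l, Encodable.encode σ, g, .noop, r, Encodable.encode l'⟩ := by
  simp [faultAutomaton, faultEdges]

lemma isTimedAutomaton_faultAutomaton : (faultAutomaton F marker).IsTimedAutomaton := by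
  have hloc : ∀ l : FaultLoc S, Encodable.encode l ∈ (faultAutomaton F marker).locs :=
    fun l => List.mem_map_of_mem (by simp)
  refine ⟨⟨?_, ?_, ?_, ?_, ?_, ?_, ?_, ?_, ?_⟩, rfl, ?_⟩
  · intro l hl
    rw [List.mem_singleton.1 hl]
    exact hloc _
  · intro l hl
    rcases List.mem_cons.1 hl with rfl | hl
    · exact hloc _
    · obtain ⟨s, -, rfl⟩ := List.mem_map.1 hl
      exact hloc _
  all_goals
    intro e he
    obtain ⟨l, σ, g, r, l', h, rfl⟩ := mem_edges_faultAutomaton.1 he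
  · exact hloc _
  · exact hloc _
  · exact List.mem_map_of_mem (by simp)
  · cases h <;> simp [faultAutomaton]
  · cases h <;> simp [faultAutomaton]
  · simp
  · simp
  · rfl

lemma step_faultAutomaton {s s' : State} {l : FaultLoc S} (hl : s.loc = Encodable.encode l)
    {δ : ℝ≥0} {σ : Phase × S} :
    (faultAutomaton F marker).Step s δ (Encodable.encode σ) s' ↔
      ∃ g r l', FaultEdge F l σ g r l' ∧ s'.loc = Encodable.encode l' ∧
        g.Sat (s.val.delay δ) ∧ s'.val = (s.val.delay δ).reset r ∧ s'.stk = s.stk := by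
  constructor
  · rintro ⟨e, he, h1, h2, h3, h4, h5, h6⟩
    obtain ⟨l₁, σ₁, g, r, l', h, rfl⟩ := mem_edges_faultAutomaton.1 he
    rw [hl] at h1
    obtain rfl := Encodable.encode_injective h1
    obtain rfl := Encodable.encode_injective h2
    exact ⟨g, r, l', h, h3.symm, h4, h5, h6⟩
  · rintro ⟨g, r, l', h, h3, h4, h5, h6⟩
    exact ⟨_, mem_edges_faultAutomaton.2 ⟨l, σ, g, r, l', h, rfl⟩, hl.symm, rfl, h3.symm, h4, h5,
      h6⟩

/-! ### The words accepted from each location of the fault automaton. -/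

variable {p : ℕ → Phase} {y : ℕ → S} {d : ℕ → ℝ≥0}

lemma acceptsFrom_done (n : ℕ) : ∀ (k : ℕ) (s : State),
    s.loc = Encodable.encode (FaultLoc.done : FaultLoc S) →
    (faultAutomaton F marker).AcceptsFrom s (cellWord p y d k n) := by
  induction n with
  | zero =>
    intro k s hs
    rw [cellWord_zero, TPDA.acceptsFrom_nil, hs]
    simp [faultAutomaton]
  | succ n ih =>
    intro k s hs
    rw [cellWord_succ, TPDA.acceptsFrom_cons]
    exact ⟨⟨_, (s.val.delay (d k)).reset [], s.stk⟩,
      (step_faultAutomaton hs).2 ⟨_, _, _, .done _, rfl, by simp [Guard.Sat], rfl, rfl⟩,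
      ih _ _ rfl⟩

lemma acceptsFrom_tie (k n : ℕ) (s : State)
    (hs : s.loc = Encodable.encode (FaultLoc.tie : FaultLoc S)) (h0 : s.val 0 = 0) :
    (faultAutomaton F marker).AcceptsFrom s (cellWord p y d k n) ↔ 0 < n ∧ d k = 0 := by
  rcases n with _ | n
  · rw [cellWord_zero, TPDA.acceptsFrom_nil, hs]
    simp [faultAutomaton]
  · rw [cellWord_succ, TPDA.acceptsFrom_cons]
    constructor
    · rintro ⟨s', hstep, -⟩
      obtain ⟨g, r, l', h, -, hg, -⟩ := (step_faultAutomaton hs).1 hstep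
      cases h
      simpa [Guard.Sat, Cmp.Holds, Valuation.delay, h0] using hg
    · rintro ⟨-, hd⟩
      exact ⟨⟨_, (s.val.delay (d k)).reset [], s.stk⟩,
        (step_faultAutomaton hs).2 ⟨_, _, _, .tied _, rfl,
          by simp [Guard.Sat, Cmp.Holds, Valuation.delay, h0, hd], rfl, rfl⟩,
        acceptsFrom_done _ _ _ rfl⟩

/-- The time at which event `k` becomes the next one. -/
def clockTime (d : ℕ → ℝ≥0) (k : ℕ) : ℝ≥0 := ∑ i ∈ Finset.range k, d i

lemma clockTime_succ (d : ℕ → ℝ≥0) (k : ℕ) : clockTime d (k + 1) = clockTime d k + d k :=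
  Finset.sum_range_succ _ _

/-- The hypothesis on `s.val 0` says that the clock measures the time since `clockTime d b`. The
location is accepting and can read everything except a correct successor at clock value one, where
the run is stuck. -/
lemma acceptsFrom_await (t : S) (b n : ℕ) : ∀ (k : ℕ) (s : State),
    s.loc = Encodable.encode (FaultLoc.await t) → clockTime d b + s.val 0 = clockTime d k →
    ((faultAutomaton F marker).AcceptsFrom s (cellWord p y d k n) ↔
      ¬ ∃ j, k ≤ j ∧ j < k + n ∧ clockTime d (j + 1) = clockTime d b + 1 ∧ p j ≠ .call ∧
        y (j + 2) = t) := by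
  induction n with
  | zero =>
    intro k s hs _
    rw [cellWord_zero, TPDA.acceptsFrom_nil, hs]
    constructor
    · rintro - ⟨j, h1, h2, -⟩
      omega
    · intro _
      simp [faultAutomaton]
  | succ n ih =>
    intro k s hs ht
    have ht' : clockTime d b + (s.val 0 + d k) = clockTime d (k + 1) := by
      rw [clockTime_succ, ← ht, add_assoc]
    have hone : s.val 0 + d k = 1 ↔ clockTime d (k + 1) = clockTime d b + 1 := by
      rw [← ht', add_right_inj]
    have hsplit : (¬ ∃ j, k ≤ j ∧ j < k + (n + 1) ∧ clockTime d (j + 1) = clockTime d b + 1 ∧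
          p j ≠ .call ∧ y (j + 2) = t) ↔
        ¬ (s.val 0 + d k = 1 ∧ p k ≠ .call ∧ y (k + 2) = t) ∧
        ¬ ∃ j, k + 1 ≤ j ∧ j < k + 1 + n ∧ clockTime d (j + 1) = clockTime d b + 1 ∧
          p j ≠ .call ∧ y (j + 2) = t := by
      rw [← not_or, hone]
      refine not_congr ⟨?_, ?_⟩
      · rintro ⟨j, h1, h2, h3⟩
        rcases Nat.eq_or_lt_of_le h1 with rfl | h1
        · exact .inl h3
        · exact .inr ⟨j, h1, by omega, h3⟩
      · rintro (h | ⟨j, h1, h2, h3⟩)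
        · exact ⟨k, le_rfl, by omega, h⟩
        · exact ⟨j, by omega, by omega, h3⟩
    rw [hsplit, cellWord_succ, TPDA.acceptsFrom_cons]
    constructor
    · rintro ⟨s', hstep, hacc⟩
      obtain ⟨g, r, l', h, hl', hg, hv, -⟩ := (step_faultAutomaton hs).1 hstep
      have hr : r = [] ∧ l' = .await t := by cases h <;> exact ⟨rfl, rfl⟩
      obtain ⟨rfl, rfl⟩ := hr
      have hv0 : s'.val 0 = s.val 0 + d k := by
        rw [hv]; simp [Valuation.reset, Valuation.delay]
      refine ⟨?_, (ih (k + 1) s' hl' (by rw [hv0, ht'])).1 hacc⟩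
      rintro ⟨h1, h2⟩
      generalize hσ : (p k, y (k + 2)) = σ at h
      cases h with
      | before | after => simp [Guard.Sat, Cmp.Holds, Valuation.delay, h1] at hg
      | wrong _ p' c' hw =>
        obtain ⟨rfl, rfl⟩ := Prod.mk.inj hσ
        exact hw h2
    · rintro ⟨h1, h2⟩
      refine ⟨⟨Encodable.encode (FaultLoc.await t), (s.val.delay (d k)).reset [], s.stk⟩,
        (step_faultAutomaton hs).2 ?_, (ih (k + 1) _ rfl ?_).2 h2⟩
      · rcases lt_trichotomy (s.val 0 + d k) 1 with hlt | heq | hgt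
        · exact ⟨_, _, _, .before _ _, rfl,
            by simpa [Guard.Sat, Cmp.Holds, Valuation.delay] using hlt, rfl, rfl⟩
        · exact ⟨_, _, _, .wrong _ _ _ fun h => h1 ⟨heq, h⟩, rfl,
            by simpa [Guard.Sat, Cmp.Holds, Valuation.delay] using heq, rfl, rfl⟩
        · exact ⟨_, _, _, .after _ _, rfl,
            by simpa [Guard.Sat, Cmp.Holds, Valuation.delay] using hgt, rfl, rfl⟩
      · simpa [Valuation.reset, Valuation.delay] using ht'

/-- Event `i` of a word of length `n` is faultless: it has the prescribed successor one time unit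
later unless it is a return, and it does not coincide with the next event. -/
def Faultless (F : S → S → S → S) (p : ℕ → Phase) (y : ℕ → S) (d : ℕ → ℝ≥0) (n i : ℕ) : Prop :=
  (p i ≠ .ret → ∃ j, i + 1 ≤ j ∧ j < n ∧ clockTime d (j + 1) = clockTime d (i + 1) + 1 ∧
    p j ≠ .call ∧ y (j + 2) = F (y i) (y (i + 1)) (y (i + 2))) ∧
  (i + 1 < n → d (i + 1) ≠ 0)

/-- At each event the automaton either moves on or bets on a missing successor or a tie at this very
event. The total length `k + n` stays the same along the induction, so faultlessness always refers
to the whole word. -/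
lemma acceptsFrom_track (n : ℕ) : ∀ (k : ℕ) (s : State),
    s.loc = Encodable.encode (FaultLoc.track (y k) (y (k + 1))) →
    ((faultAutomaton F marker).AcceptsFrom s (cellWord p y d k n) ↔
      ¬ ∀ i, k ≤ i → i < k + n → Faultless F p y d (k + n) i) := by
  induction n with
  | zero =>
    intro k s hs
    rw [cellWord_zero, TPDA.acceptsFrom_nil, hs]
    constructor
    · simp [faultAutomaton]
    · exact fun h => absurd (fun i h1 h2 => by omega) h
  | succ n ih =>
    intro k s hs
    have hsplit : (¬ ∀ i, k ≤ i → i < k + (n + 1) → Faultless F p y d (k + (n + 1)) i) ↔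
        (¬ ∀ i, k + 1 ≤ i → i < k + 1 + n → Faultless F p y d (k + 1 + n) i) ∨
        (p k ≠ .ret ∧ ¬ ∃ j, k + 1 ≤ j ∧ j < k + 1 + n ∧
          clockTime d (j + 1) = clockTime d (k + 1) + 1 ∧ p j ≠ .call ∧
            y (j + 2) = F (y k) (y (k + 1)) (y (k + 2))) ∨
        (0 < n ∧ d (k + 1) = 0) := by
      have hk : Faultless F p y d (k + 1 + n) k ↔ ¬ ((p k ≠ .ret ∧ ¬ ∃ j, k + 1 ≤ j ∧
          j < k + 1 + n ∧ clockTime d (j + 1) = clockTime d (k + 1) + 1 ∧ p j ≠ .call ∧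
            y (j + 2) = F (y k) (y (k + 1)) (y (k + 2))) ∨ (0 < n ∧ d (k + 1) = 0)) := by
        rw [Faultless, not_or, not_and_not_right, not_and, Nat.lt_add_right_iff_pos]
      rw [← not_iff_not, not_or, ← hk, not_not, not_not, show k + (n + 1) = k + 1 + n by omega]
      constructor
      · exact fun h => ⟨fun i h1 h2 => h i (by omega) h2, h k le_rfl (by omega)⟩
      · rintro ⟨h, hk⟩ i h1 h2
        rcases Nat.eq_or_lt_of_le h1 with rfl | h1
        · exact hk
        · exact h i h1 h2
    rw [hsplit, cellWord_succ, TPDA.acceptsFrom_cons]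
    have hreset : ∀ {s' : State}, s'.val = (s.val.delay (d k)).reset [0] → s'.val 0 = 0 := by
      intro s' h
      rw [h]; simp [Valuation.reset]
    constructor
    · rintro ⟨s', hstep, hacc⟩
      obtain ⟨g, r, l', h, hl', hg, hv, -⟩ := (step_faultAutomaton hs).1 hstep
      generalize hσ : (p k, y (k + 2)) = σ at h
      cases h with
      | track =>
        obtain ⟨rfl, rfl⟩ := Prod.mk.inj hσ
        exact .inl ((ih (k + 1) s' hl').1 hacc)
      | guess _ _ p' c hp =>
        obtain ⟨rfl, rfl⟩ := Prod.mk.inj hσ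
        exact .inr (.inl ⟨hp, (acceptsFrom_await _ (k + 1) n (k + 1) s' hl'
          (by rw [hreset hv, add_zero])).1 hacc⟩)
      | tie => exact .inr (.inr ((acceptsFrom_tie _ _ s' hl' (hreset hv)).1 hacc))
    · rintro (h | ⟨hp, h⟩ | h)
      · exact ⟨⟨Encodable.encode (FaultLoc.track (y (k + 1)) (y (k + 2))),
          (s.val.delay (d k)).reset [], s.stk⟩,
          (step_faultAutomaton hs).2 ⟨_, _, _, .track _ _ _ _, rfl, by simp [Guard.Sat], rfl, rfl⟩,
          (ih (k + 1) _ rfl).2 h⟩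
      · exact ⟨⟨Encodable.encode (FaultLoc.await (F (y k) (y (k + 1)) (y (k + 2)))),
          (s.val.delay (d k)).reset [0], s.stk⟩,
          (step_faultAutomaton hs).2
            ⟨_, _, _, .guess _ _ _ _ hp, rfl, by simp [Guard.Sat], rfl, rfl⟩,
          (acceptsFrom_await _ (k + 1) n (k + 1) _ rfl (by rw [hreset rfl, add_zero])).2 h⟩
      · exact ⟨⟨Encodable.encode (FaultLoc.tie : FaultLoc S),
          (s.val.delay (d k)).reset [0], s.stk⟩,
          (step_faultAutomaton hs).2 ⟨_, _, _, .tie _ _ _, rfl, by simp [Guard.Sat], rfl, rfl⟩,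
          (acceptsFrom_tie _ _ _ rfl (hreset rfl)).2 h⟩

theorem accepts_faultAutomaton_iff (h0 : y 0 = marker) (h1 : y 1 = marker) (n : ℕ) :
    (faultAutomaton F marker).Accepts (cellWord p y d 0 n) ↔
      ¬ ∀ i < n, Faultless F p y d n i := by
  have key : ∀ s : State, s.loc = Encodable.encode (FaultLoc.track marker marker) →
      ((faultAutomaton F marker).AcceptsFrom s (cellWord p y d 0 n) ↔
        ¬ ∀ i < n, Faultless F p y d n i) := by
    intro s hs
    rw [acceptsFrom_track n 0 s (by rw [hs, h0, h1])]
    simp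
  constructor
  · rintro ⟨s, hs, -, -, h⟩
    exact (key s (List.mem_singleton.1 hs)).1 h
  · exact fun h => ⟨⟨_, fun _ => 0, []⟩, List.mem_singleton.2 rfl, fun _ _ => rfl, rfl,
      (key _ rfl).2 h⟩

end Faults

/-! ### The net that accepts the words of the right shape -/

section Net

variable {S : Type}

/-- The input cells of the machine: its first two tape cells, the cell repeated after them, and the
blank cell around them. -/
structure InputCells (S : Type) where
  blank : S
  fst : S
  snd : S
  rest : S

/-- The edges of the net. Location `0` reads blanks and the first input cell, location `1` the
second one, location `i + 4` reads `i` further input cells, location `4` blanks, location `2`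
internal symbols up to a return symbol with a halted cell, and location `3` return symbols. -/
inductive NetEdge (I : InputCells S) (H : S → Prop) (m : ℕ) : ℕ → Phase × S → ℕ → Prop
  | pre : NetEdge I H m 0 (.call, I.blank) 0
  | fst : NetEdge I H m 0 (.call, I.fst) 1
  | snd : NetEdge I H m 1 (.call, I.snd) (m + 4)
  | rest (i : ℕ) : i < m → NetEdge I H m (i + 5) (.call, I.rest) (i + 4)
  | post : NetEdge I H m 4 (.call, I.blank) 4
  | start (s : S) : NetEdge I H m 4 (.int, s) 2
  | int (s : S) : NetEdge I H m 2 (.int, s) 2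
  | halt (s : S) : H s → NetEdge I H m 2 (.ret, s) 3
  | ret (s : S) : NetEdge I H m 3 (.ret, s) 3

variable {I : InputCells S} {H : S → Prop} {m : ℕ}

/-- Only location `0` has two edges that could carry the same symbol, namely a blank and the first
input cell. -/
lemma NetEdge.tgt_unique (hI : I.fst ≠ I.blank) {l : ℕ} {σ : Phase × S} {l₁ l₂ : ℕ}
    (h₁ : NetEdge I H m l σ l₁) (h₂ : NetEdge I H m l σ l₂) : l₁ = l₂ := by
  generalize hl : l = l' at h₂
  generalize hσ : σ = σ' at h₂
  cases h₁ <;> cases h₂ <;> first | rfl | omega | simp_all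

/-- The effect of a symbol on the height of the stack. -/
def Phase.Height : Phase → ℕ → ℕ → Prop
  | .int, h, h' => h' = h
  | .call, h, h' => h' = h + 1
  | .ret, h, h' => h = h' + 1

/-- The net accepts the events `k, …, k + n - 1` from location `l` and stack height `h`. -/
def NetAccepts (I : InputCells S) (H : S → Prop) (m : ℕ) (p : ℕ → Phase) (y : ℕ → S) :
    ℕ → ℕ → ℕ → ℕ → Prop
  | 0, _, l, _ => l = 3
  | n + 1, k, l, h => ∃ l' h', NetEdge I H m l (p k, y (k + 2)) l' ∧ (p k).Height h h' ∧
      NetAccepts I H m p y n (k + 1) l' h'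

/-! ### The words accepted from each location of the net. -/

variable {p : ℕ → Phase} {y : ℕ → S} {d : ℕ → ℝ≥0}

lemma netAccepts_ret (n : ℕ) : ∀ k h, NetAccepts I H m p y n k 3 h ↔
    n ≤ h ∧ ∀ i, k ≤ i → i < k + n → p i = .ret := by
  induction n with
  | zero =>
    intro k h
    simp only [NetAccepts, Nat.zero_le, true_and, true_iff]
    intros
    omega
  | succ n ih =>
    intro k h
    rw [NetAccepts]
    constructor
    · rintro ⟨l', h', he, hh, hacc⟩
      generalize hσ : (p k, y (k + 2)) = σ at he
      cases he
      obtain ⟨hp, -⟩ := Prod.mk.inj hσ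
      rw [hp] at hh
      obtain rfl : h = h' + 1 := hh
      obtain ⟨h1, h2⟩ := (ih _ _).1 hacc
      refine ⟨by omega, fun i hi hi' => ?_⟩
      rcases Nat.eq_or_lt_of_le hi with rfl | hi
      · exact hp
      · exact h2 i hi (by omega)
    · rintro ⟨h1, h2⟩
      obtain ⟨h, rfl⟩ : ∃ h', h = h' + 1 := ⟨h - 1, by omega⟩
      have hp := h2 k le_rfl (by omega)
      refine ⟨3, h, ?_, ?_, (ih _ _).2 ⟨by omega, fun i hi hi' => h2 i (by omega) (by omega)⟩⟩
      · rw [hp]; exact .ret _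
      · rw [hp]; rfl

/-- The last condition `k + n ≤ q + h` is all that the counter contributes: internal events keep the
height `h`, and each return lowers it by one. -/
lemma netAccepts_int (n : ℕ) : ∀ k h, NetAccepts I H m p y n k 2 h ↔
    ∃ q, k ≤ q ∧ q < k + n ∧ (∀ i, k ≤ i → i < q → p i = .int) ∧
      (∀ i, q ≤ i → i < k + n → p i = .ret) ∧ H (y (q + 2)) ∧ k + n ≤ q + h := by
  induction n with
  | zero =>
    intro k h
    simp only [NetAccepts]
    constructor
    · intro h; omega
    · rintro ⟨q, h1, h2, -⟩; omega
  | succ n ih =>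
    intro k h
    rw [NetAccepts]
    constructor
    · rintro ⟨l', h', he, hh, hacc⟩
      generalize hσ : (p k, y (k + 2)) = σ at he
      cases he with
      | int s =>
        obtain ⟨hp, -⟩ := Prod.mk.inj hσ
        rw [hp] at hh
        obtain rfl : h' = h := hh
        obtain ⟨q, h1, h2, h3, h4, h5, h6⟩ := (ih _ _).1 hacc
        refine ⟨q, by omega, by omega, fun i hi hi' => ?_, fun i hi hi' => h4 i hi (by omega),
          h5, by omega⟩
        rcases Nat.eq_or_lt_of_le hi with rfl | hi
        · exact hp
        · exact h3 i hi hi'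
      | halt s hs =>
        obtain ⟨hp, rfl⟩ := Prod.mk.inj hσ
        rw [hp] at hh
        obtain rfl : h = h' + 1 := hh
        obtain ⟨h1, h2⟩ := (netAccepts_ret _ _ _).1 hacc
        refine ⟨k, le_rfl, by omega, fun i hi hi' => by omega, fun i hi hi' => ?_, hs, by omega⟩
        rcases Nat.eq_or_lt_of_le hi with rfl | hi
        · exact hp
        · exact h2 i hi (by omega)
    · rintro ⟨q, h1, h2, h3, h4, h5, h6⟩
      rcases Nat.eq_or_lt_of_le h1 with rfl | h1
      · obtain ⟨h, rfl⟩ : ∃ h', h = h' + 1 := ⟨h - 1, by omega⟩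
        have hp := h4 k le_rfl (by omega)
        refine ⟨3, h, ?_, ?_, (netAccepts_ret _ _ _).2
          ⟨by omega, fun i hi hi' => h4 i (by omega) (by omega)⟩⟩
        · rw [hp]; exact .halt _ h5
        · rw [hp]; rfl
      · have hp := h3 k le_rfl h1
        refine ⟨2, h, ?_, ?_, (ih _ _).2 ⟨q, h1, by omega, fun i hi hi' => h3 i (by omega) hi',
          fun i hi hi' => h4 i hi (by omega), h5, by omega⟩⟩
        · rw [hp]; exact .int _
        · rw [hp]; rfl

/-- The input of length `m + 2` that starts at position `a`, between blanks. -/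
def InputCells.word (I : InputCells S) (m a i : ℕ) : S :=
  if i < a then I.blank else if i = a then I.fst else if i = a + 1 then I.snd else
    if i < a + 2 + m then I.rest else I.blank

/-- The events `k, …, e - 1` consist of calls with cells `w` before position `C`, internal events
before position `q`, and then at most `C` returns, of which the first has a halted cell. -/
structure HaltingShape (H : S → Prop) (w : ℕ → S) (p : ℕ → Phase) (y : ℕ → S)
    (k e C q : ℕ) : Prop where
  le : k ≤ C
  lt : C < q
  lt_end : q < e
  call : ∀ i, k ≤ i → i < C → p i = .call ∧ y (i + 2) = w i
  int : ∀ i, C ≤ i → i < q → p i = .int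
  ret : ∀ i, q ≤ i → i < e → p i = .ret
  halted : H (y (q + 2))
  end_le : e ≤ q + C

lemma HaltingShape.cons {w : ℕ → S} {k e C q : ℕ} (h : HaltingShape H w p y (k + 1) e C q)
    (hp : p k = .call) (hy : y (k + 2) = w k) : HaltingShape H w p y k e C q where
  le := (Nat.le_succ k).trans h.le
  lt := h.lt
  lt_end := h.lt_end
  call i hi hi' := by
    rcases Nat.eq_or_lt_of_le hi with rfl | hi
    · exact ⟨hp, hy⟩
    · exact h.call i hi hi'
  int := h.int
  ret := h.ret
  halted := h.halted
  end_le := h.end_le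

lemma HaltingShape.tail {w : ℕ → S} {k e C q : ℕ} (h : HaltingShape H w p y k e C q)
    (hk : k < C) : HaltingShape H w p y (k + 1) e C q where
  le := hk
  lt := h.lt
  lt_end := h.lt_end
  call i hi hi' := h.call i (by omega) hi'
  int := h.int
  ret := h.ret
  halted := h.halted
  end_le := h.end_le

/-- So far only calls have been read, hence the stack height equals the position `k`. When the calls
stop at position `C`, the height `C` bounds the number of returns. -/
lemma netAccepts_blank (a n : ℕ) : ∀ k, a + 2 + m ≤ k → (NetAccepts I H m p y n k 4 k ↔
    ∃ C q, HaltingShape H (I.word m a) p y k (k + n) C q) := by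
  induction n with
  | zero =>
    intro k _
    simp only [NetAccepts]
    constructor
    · intro h; omega
    · rintro ⟨C, q, h⟩
      have := h.le; have := h.lt; have := h.lt_end
      omega
  | succ n ih =>
    intro k hk
    have hw : I.word m a k = I.blank := by
      unfold InputCells.word
      rw [if_neg (by omega), if_neg (by omega), if_neg (by omega), if_neg (by omega)]
    rw [NetAccepts, show k + (n + 1) = k + 1 + n by omega]
    constructor
    · rintro ⟨l', h', he, hh, hacc⟩
      generalize hσ : (p k, y (k + 2)) = σ at he
      generalize hl : 4 = l at he
      cases he with
      | post =>
        obtain ⟨hp, hy⟩ := Prod.mk.inj hσ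
        rw [hp] at hh
        obtain rfl : h' = k + 1 := hh
        obtain ⟨C, q, hs⟩ := (ih _ (by omega)).1 hacc
        exact ⟨C, q, hs.cons hp (by rw [hy, hw])⟩
      | start s =>
        obtain ⟨hp, -⟩ := Prod.mk.inj hσ
        rw [hp] at hh
        obtain rfl : h' = k := hh
        obtain ⟨q, h1, h2, h3, h4, h5, h6⟩ := (netAccepts_int _ _ _).1 hacc
        refine ⟨h', q, le_rfl, by omega, h2, fun i hi hi' => by omega, fun i hi hi' => ?_,
          h4, h5, by omega⟩
        rcases Nat.eq_or_lt_of_le hi with rfl | hi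
        · exact hp
        · exact h3 i hi hi'
      | _ => omega
    · rintro ⟨C, q, hs⟩
      rcases Nat.eq_or_lt_of_le hs.le with rfl | hkC
      · have hp := hs.int k le_rfl hs.lt
        refine ⟨2, k, ?_, ?_, (netAccepts_int _ _ _).2 ⟨q, hs.lt, hs.lt_end,
          fun i hi hi' => hs.int i (by omega) hi', hs.ret, hs.halted, hs.end_le⟩⟩
        · rw [hp]; exact .start _
        · rw [hp]; rfl
      · obtain ⟨hp, hy⟩ := hs.call k le_rfl hkC
        refine ⟨4, k + 1, ?_, ?_, (ih _ (by omega)).2 ⟨C, q, hs.tail hkC⟩⟩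
        · rw [hp, hy, hw]; exact .post
        · rw [hp]; rfl

lemma netAccepts_rest (a j : ℕ) : ∀ n k, j ≤ m → k + j = a + 2 + m →
    (NetAccepts I H m p y n k (j + 4) k ↔
      ∃ C q, a + 2 + m ≤ C ∧ HaltingShape H (I.word m a) p y k (k + n) C q) := by
  induction j with
  | zero =>
    intro n k _ hk
    rw [netAccepts_blank a n k (by omega)]
    exact ⟨fun ⟨C, q, h⟩ => ⟨C, q, by have := h.le; omega, h⟩, fun ⟨C, q, _, h⟩ => ⟨C, q, h⟩⟩
  | succ j ih =>
    intro n k hj hk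
    have hw : I.word m a k = I.rest := by
      unfold InputCells.word
      rw [if_neg (by omega), if_neg (by omega), if_neg (by omega), if_pos (by omega)]
    rcases n with _ | n
    · simp only [NetAccepts]
      constructor
      · intro h; omega
      · rintro ⟨C, q, -, h⟩
        have := h.le; have := h.lt; have := h.lt_end
        omega
    rw [NetAccepts, show k + (n + 1) = k + 1 + n by omega]
    constructor
    · rintro ⟨l', h', he, hh, hacc⟩
      generalize hσ : (p k, y (k + 2)) = σ at he
      generalize hl : j + 1 + 4 = l at he
      cases he with
      | rest i hi =>
        obtain ⟨hp, hy⟩ := Prod.mk.inj hσ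
        obtain rfl : i = j := by omega
        rw [hp] at hh
        obtain rfl : h' = k + 1 := hh
        obtain ⟨C, q, hC, hs⟩ := (ih n _ (by omega) (by omega)).1 hacc
        exact ⟨C, q, hC, hs.cons hp (by rw [hy, hw])⟩
      | _ => omega
    · rintro ⟨C, q, hC, hs⟩
      obtain ⟨hp, hy⟩ := hs.call k le_rfl (by omega)
      refine ⟨j + 4, k + 1, ?_, ?_,
        (ih n _ (by omega) (by omega)).2 ⟨C, q, hC, hs.tail (by omega)⟩⟩
      · rw [hp, hy, hw]; exact .rest j (by omega)
      · rw [hp]; rfl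

lemma netAccepts_snd (n a : ℕ) : NetAccepts I H m p y n (a + 1) 1 (a + 1) ↔
    ∃ C q, a + 2 + m ≤ C ∧ HaltingShape H (I.word m a) p y (a + 1) (a + 1 + n) C q := by
  have hw : I.word m a (a + 1) = I.snd := by simp [InputCells.word]
  rcases n with _ | n
  · simp only [NetAccepts]
    constructor
    · intro h; omega
    · rintro ⟨C, q, -, h⟩
      have := h.le; have := h.lt; have := h.lt_end
      omega
  rw [NetAccepts, show a + 1 + (n + 1) = a + 1 + 1 + n by omega]
  constructor
  · rintro ⟨l', h', he, hh, hacc⟩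
    generalize hσ : (p (a + 1), y (a + 1 + 2)) = σ at he
    cases he
    obtain ⟨hp, hy⟩ := Prod.mk.inj hσ
    rw [hp] at hh
    obtain rfl : h' = a + 1 + 1 := hh
    obtain ⟨C, q, hC, hs⟩ := (netAccepts_rest a m n _ le_rfl (by omega)).1 hacc
    exact ⟨C, q, hC, hs.cons hp (by rw [hy, hw])⟩
  · rintro ⟨C, q, hC, hs⟩
    obtain ⟨hp, hy⟩ := hs.call (a + 1) le_rfl (by omega)
    refine ⟨m + 4, a + 1 + 1, ?_, ?_,
      (netAccepts_rest a m n _ le_rfl (by omega)).2 ⟨C, q, hC, hs.tail (by omega)⟩⟩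
    · rw [hp, hy, hw]; exact .snd
    · rw [hp]; rfl

/-- The numbers of blanks on both sides of the input are left to the word, so the window can be as
wide as a computation requires. -/
lemma netAccepts_init (n : ℕ) : ∀ k, NetAccepts I H m p y n k 0 k ↔
    ∃ a C q, k ≤ a ∧ a + 2 + m ≤ C ∧ HaltingShape H (I.word m a) p y k (k + n) C q := by
  induction n with
  | zero =>
    intro k
    simp only [NetAccepts]
    constructor
    · intro h; omega
    · rintro ⟨a, C, q, -, -, h⟩
      have := h.le; have := h.lt; have := h.lt_end
      omega
  | succ n ih =>
    intro k
    have hw : ∀ a, k < a → I.word m a k = I.blank := fun a h => by simp [InputCells.word, h]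
    have hw' : I.word m k k = I.fst := by simp [InputCells.word]
    rw [NetAccepts, show k + (n + 1) = k + 1 + n by omega]
    constructor
    · rintro ⟨l', h', he, hh, hacc⟩
      generalize hσ : (p k, y (k + 2)) = σ at he
      cases he with
      | pre =>
        obtain ⟨hp, hy⟩ := Prod.mk.inj hσ
        rw [hp] at hh
        obtain rfl : h' = k + 1 := hh
        obtain ⟨a, C, q, ha, hC, hs⟩ := (ih _).1 hacc
        exact ⟨a, C, q, by omega, hC, hs.cons hp (by rw [hy, hw a (by omega)])⟩
      | fst =>
        obtain ⟨hp, hy⟩ := Prod.mk.inj hσ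
        rw [hp] at hh
        obtain rfl : h' = k + 1 := hh
        obtain ⟨C, q, hC, hs⟩ := (netAccepts_snd _ _).1 hacc
        exact ⟨k, C, q, le_rfl, hC, hs.cons hp (by rw [hy, hw'])⟩
    · rintro ⟨a, C, q, ha, hC, hs⟩
      obtain ⟨hp, hy⟩ := hs.call k le_rfl (by omega)
      rcases Nat.eq_or_lt_of_le ha with rfl | ha
      · refine ⟨1, k + 1, ?_, ?_, (netAccepts_snd _ _).2 ⟨C, q, hC, hs.tail (by omega)⟩⟩
        · rw [hp, hy, hw']; exact .fst
        · rw [hp]; rfl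
      · refine ⟨0, k + 1, ?_, ?_, (ih _).2 ⟨a, C, q, ha, hC, hs.tail (by omega)⟩⟩
        · rw [hp, hy, hw a ha]; exact .pre
        · rw [hp]; rfl

/-! ### The automaton -/

variable [Encodable S]

/-- The stack operation that belongs to a kind of symbol. -/
def Phase.op : Phase → Op
  | .int => .noop
  | .call => .push 0
  | .ret => .pop 0

/-- An edge without guard and resets. -/
def netEdge (l : ℕ) (σ : Phase × S) (l' : ℕ) : Edge :=
  ⟨l, Encodable.encode σ, [], σ.1.op, [], l'⟩

variable [Fintype S]

open Classical in
/-- The edges that do not depend on the length of the input. -/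
noncomputable def fixedNetEdges (I : InputCells S) (H : S → Prop) : List Edge :=
  [netEdge 0 (.call, I.blank) 0, netEdge 0 (.call, I.fst) 1, netEdge 4 (.call, I.blank) 4] ++
  (Finset.univ : Finset S).toList.map (fun s => netEdge 4 (.int, s) 2) ++
  (Finset.univ : Finset S).toList.map (fun s => netEdge 2 (.int, s) 2) ++
  (Finset.univ.filter H).toList.map (fun s => netEdge 2 (.ret, s) 3) ++
  (Finset.univ : Finset S).toList.map (fun s => netEdge 3 (.ret, s) 3)

/-- The net that accepts the words whose calls spell an input of length `m + 2` between blanks,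
whose first return is a halted cell, and that have at most as many returns as calls. -/
noncomputable def haltingNet (I : InputCells S) (H : S → Prop) (m : ℕ) : TPDA where
  alphabet := (Finset.univ : Finset (Phase × S)).toList.map Encodable.encode
  stack := [0]
  locs := List.range (m + 5)
  init := [0]
  final := [3]
  clocks := []
  edges := netEdge 1 (.call, I.snd) (m + 4) ::
    ((List.range m).map fun i => netEdge (i + 5) (.call, I.rest) (i + 4)) ++ fixedNetEdges I H

lemma mem_edges_haltingNet {e : Edge} : e ∈ (haltingNet I H m).edges ↔
    ∃ l σ l', NetEdge I H m l σ l' ∧ e = netEdge l σ l' := by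
  constructor
  · intro h
    simp only [haltingNet, fixedNetEdges, List.mem_append, List.mem_cons, List.mem_map,
      List.mem_range, Finset.mem_toList, Finset.mem_univ, true_and, Finset.mem_filter,
      List.not_mem_nil, or_false] at h
    rcases h with (rfl | ⟨i, hi, rfl⟩) | ((((rfl | rfl | rfl) | ⟨s, rfl⟩) | ⟨s, rfl⟩) |
      ⟨s, hs, rfl⟩) | ⟨s, rfl⟩
    · exact ⟨_, _, _, .snd, rfl⟩
    · exact ⟨_, _, _, .rest i hi, rfl⟩
    · exact ⟨_, _, _, .pre, rfl⟩
    · exact ⟨_, _, _, .fst, rfl⟩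
    · exact ⟨_, _, _, .post, rfl⟩
    · exact ⟨_, _, _, .start s, rfl⟩
    · exact ⟨_, _, _, .int s, rfl⟩
    · exact ⟨_, _, _, .halt s hs, rfl⟩
    · exact ⟨_, _, _, .ret s, rfl⟩
  · rintro ⟨l, σ, l', h, rfl⟩
    simp only [haltingNet, fixedNetEdges, List.mem_append, List.mem_cons, List.mem_map,
      List.mem_range, Finset.mem_toList, Finset.mem_univ, true_and, Finset.mem_filter,
      List.not_mem_nil, or_false]
    cases h with
    | pre | fst | snd | post => simp
    | rest i hi => exact .inl (.inr ⟨i, hi, rfl⟩)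
    | start s => exact .inr (.inl (.inl (.inl (.inr ⟨s, rfl⟩))))
    | int s => exact .inr (.inl (.inl (.inr ⟨s, rfl⟩)))
    | halt s hs => exact .inr (.inl (.inr ⟨s, hs, rfl⟩))
    | ret s => exact .inr (.inr ⟨s, rfl⟩)

lemma isTimedVisiblyOneCounterNet_haltingNet :
    (haltingNet I H m).IsTimedVisiblyOneCounterNet := by
  refine ⟨⟨?_, ?_, ?_, ?_, ?_, ?_, ?_, ?_, ?_⟩, ⟨0, by simp [haltingNet]⟩, ?_, ?_⟩
  · simp [haltingNet]
  · simp [haltingNet]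
  · intro e he
    obtain ⟨l, σ, l', h, rfl⟩ := mem_edges_haltingNet.1 he
    simp only [haltingNet, netEdge, List.mem_range]
    cases h <;> omega
  · intro e he
    obtain ⟨l, σ, l', h, rfl⟩ := mem_edges_haltingNet.1 he
    simp only [haltingNet, netEdge, List.mem_range]
    cases h <;> omega
  · intro e he
    obtain ⟨l, σ, l', h, rfl⟩ := mem_edges_haltingNet.1 he
    exact List.mem_map_of_mem (by simp)
  · intro e he
    obtain ⟨l, σ, l', h, rfl⟩ := mem_edges_haltingNet.1 he
    simp [netEdge]
  · intro e he
    obtain ⟨l, σ, l', h, rfl⟩ := mem_edges_haltingNet.1 he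
    simp [netEdge]
  · intro e he γ hγ
    obtain ⟨l, ⟨p, s⟩, l', h, rfl⟩ := mem_edges_haltingNet.1 he
    cases p <;> simp_all [netEdge, Phase.op, haltingNet]
  · intro e he γ hγ
    obtain ⟨l, ⟨p, s⟩, l', h, rfl⟩ := mem_edges_haltingNet.1 he
    cases p <;> simp_all [netEdge, Phase.op, haltingNet]
  · intro e he
    obtain ⟨l, ⟨p, s⟩, l', h, rfl⟩ := mem_edges_haltingNet.1 he
    cases p <;> simp [netEdge, Phase.op]
  · let K : Phase → Set ℕ := fun p => Set.range fun s : S => Encodable.encode (p, s)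
    have hmem : ∀ (p p' : Phase) (s : S), Encodable.encode (p, s) ∈ K p' ↔ p = p' := by
      intro p p' s
      constructor
      · rintro ⟨s', h⟩
        exact (Prod.mk.inj (Encodable.encode_injective h)).1.symm
      · rintro rfl
        exact ⟨s, rfl⟩
    have hdisj : ∀ p p', p ≠ p' → Disjoint (K p) (K p') := by
      intro p p' h
      rw [Set.disjoint_left]
      rintro _ ⟨s, rfl⟩ h'
      exact h ((hmem _ _ _).1 h')
    refine ⟨K .int, K .call, K .ret, ?_, hdisj _ _ (by simp), hdisj _ _ (by simp),
      hdisj _ _ (by simp), ?_⟩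
    · ext a
      constructor
      · intro ha
        obtain ⟨⟨p, s⟩, -, rfl⟩ := List.mem_map.1 ha
        cases p
        · exact .inl (.inl ⟨s, rfl⟩)
        · exact .inl (.inr ⟨s, rfl⟩)
        · exact .inr ⟨s, rfl⟩
      · rintro ((⟨s, rfl⟩ | ⟨s, rfl⟩) | ⟨s, rfl⟩) <;> exact List.mem_map_of_mem (by simp)
    · intro e he
      obtain ⟨l, ⟨p, s⟩, l', h, rfl⟩ := mem_edges_haltingNet.1 he
      simp only [netEdge, hmem]
      cases p <;> simp [Phase.op]

lemma isDeterministic_haltingNet (hI : I.fst ≠ I.blank) :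
    (haltingNet I H m).IsDeterministic := by
  intro e he e' he' hsrc hsym hne
  obtain ⟨l, σ, l₁, h₁, rfl⟩ := mem_edges_haltingNet.1 he
  obtain ⟨l', σ', l₂, h₂, rfl⟩ := mem_edges_haltingNet.1 he'
  obtain rfl : l = l' := hsrc
  obtain rfl : σ = σ' := Encodable.encode_injective hsym
  exact absurd (by rw [h₁.tgt_unique hI h₂]) hne

lemma sameAlphabet_haltingNet (F : S → S → S → S) (marker : S) :
    (haltingNet I H m).SameAlphabet (faultAutomaton F marker) :=
  fun _ => Iff.rfl

/-- With a single stack symbol the height carries all information about the stack. -/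
lemma Phase.effect_iff (φ : Phase) (h : ℕ) (u : List ℕ) :
    φ.op.Effect (List.replicate h 0) u ↔ ∃ h', φ.Height h h' ∧ u = List.replicate h' 0 := by
  cases φ with
  | int => simp [op, Op.Effect, Height]
  | call => simp [op, Op.Effect, Height, List.replicate_succ]
  | ret =>
    constructor
    · intro hu
      simp only [op, Op.Effect] at hu
      rcases h with _ | h
      · simp at hu
      · rw [List.replicate_succ, List.cons.injEq] at hu
        exact ⟨h, rfl, hu.2.symm⟩
    · rintro ⟨h', hh, rfl⟩
      obtain rfl : h = h' + 1 := hh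
      rfl

lemma acceptsFrom_haltingNet (n : ℕ) : ∀ (k h : ℕ) (s : State), s.stk = List.replicate h 0 →
    ((haltingNet I H m).AcceptsFrom s (cellWord p y d k n) ↔
      NetAccepts I H m p y n k s.loc h) := by
  induction n with
  | zero =>
    intro k h s _
    rw [cellWord_zero, TPDA.acceptsFrom_nil, NetAccepts]
    simp [haltingNet]
  | succ n ih =>
    intro k h s hs
    rw [cellWord_succ, TPDA.acceptsFrom_cons, NetAccepts]
    constructor
    · rintro ⟨s', ⟨e, he, h1, h2, h3, -, -, h6⟩, hacc⟩
      obtain ⟨l, σ, l', hedge, rfl⟩ := mem_edges_haltingNet.1 he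
      obtain rfl := Encodable.encode_injective h2
      obtain rfl : l = s.loc := h1
      obtain rfl : l' = s'.loc := h3
      rw [hs] at h6
      obtain ⟨h', hh', hu⟩ := (Phase.effect_iff _ _ _).1 h6
      exact ⟨_, h', hedge, hh', (ih _ _ s' hu).1 hacc⟩
    · rintro ⟨l', h', hedge, hh', hacc⟩
      refine ⟨⟨l', (s.val.delay (d k)).reset [], List.replicate h' 0⟩,
        ⟨_, mem_edges_haltingNet.2 ⟨_, _, _, hedge, rfl⟩, rfl, rfl, rfl, ?_, rfl, ?_⟩,
        (ih _ h' _ rfl).2 hacc⟩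
      · simp [netEdge, Guard.Sat]
      · rw [hs]
        exact (Phase.effect_iff _ _ _).2 ⟨h', hh', rfl⟩

theorem accepts_haltingNet_iff (n : ℕ) :
    (haltingNet I H m).Accepts (cellWord p y d 0 n) ↔
      ∃ a C q, a + 2 + m ≤ C ∧ HaltingShape H (I.word m a) p y 0 n C q := by
  have key : ∀ s : State, s.loc = 0 → s.stk = [] →
      ((haltingNet I H m).AcceptsFrom s (cellWord p y d 0 n) ↔
        ∃ a C q, a + 2 + m ≤ C ∧ HaltingShape H (I.word m a) p y 0 n C q) := by
    intro s hs hs'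
    rw [acceptsFrom_haltingNet n 0 0 s hs', hs, netAccepts_init]
    simp
  constructor
  · rintro ⟨s, hs, -, hs', h⟩
    exact (key s (List.mem_singleton.1 hs) hs').1 h
  · exact fun h => ⟨⟨0, fun _ => 0, []⟩, List.mem_singleton.2 rfl, fun _ _ => rfl, rfl,
      (key _ rfl rfl).2 h⟩

/-! ### Computability of the reduction -/

/-- Only the locations, the edge for the second input cell and the chain after it vary with `m`. The
rest is a constant, for which the classical choices in `fixedNetEdges` do no harm. -/
lemma computable_haltingNet (I : InputCells S) (H : S → Prop) :
    Computable fun m => haltingNet I H m := by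
  have hadd : ∀ c : ℕ, Primrec fun i : ℕ => i + c := fun c =>
    Primrec.nat_add.comp .id (.const c)
  have hedge : ∀ (f g : ℕ → ℕ) (σ : Phase × S), Primrec f → Primrec g →
      Primrec fun i => netEdge (f i) σ (g i) := by
    intro f g σ hf hg
    exact (Primrec.of_equiv_symm (e := Edge.equivProd)).comp
      (hf.pair ((Primrec.const _).pair ((Primrec.const _).pair ((Primrec.const _).pair
        ((Primrec.const _).pair hg)))))
  have hmap : Primrec fun m : ℕ =>
      (List.range m).map fun i => netEdge (i + 5) (.call, I.rest) (i + 4) :=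
    Primrec.list_map Primrec.list_range
      ((hedge _ _ _ (hadd 5) (hadd 4)).comp Primrec.snd).to₂
  have hedges : Primrec fun m : ℕ => (haltingNet I H m).edges :=
    Primrec.list_append.comp
      (Primrec.list_cons.comp (hedge _ _ _ (.const 1) (hadd 4)) hmap) (.const _)
  exact ((Primrec.of_equiv_symm (e := TPDA.equivProd)).comp
    ((Primrec.const _).pair ((Primrec.const _).pair ((Primrec.list_range.comp (hadd 5)).pair
      ((Primrec.const _).pair ((Primrec.const _).pair ((Primrec.const _).pair hedges))))))).to_comp

end Net

/-! ### Faultless words of the right shape are helices -/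

section Faultless

variable {S : Type} {F : S → S → S → S} {marker : S} {H : S → Prop} {w : ℕ → S}
  {p : ℕ → Phase} {y : ℕ → S} {d : ℕ → ℝ≥0} {n C q : ℕ}

/-- In a faultless word every event before the returns has its successor exactly `C` events later:
successors are distinct, and the returns at the end are too few for any surplus events. -/
lemma eq_helix_rule_of_faultless (hs : HaltingShape H w p y 0 n C q)
    (hf : ∀ i < n, Faultless F p y d n i) {i : ℕ} (hi : i < q) :
    y (i + C + 2) = F (y i) (y (i + 1)) (y (i + 2)) := by
  have hq := hs.lt_end
  have hmono : ∀ i j, i < j → j < n → clockTime d (i + 1) < clockTime d (j + 1) := by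
    intro i j hij
    induction j, hij using Nat.le_induction with
    | base =>
      intro hn
      rw [clockTime_succ d (i + 1)]
      exact lt_add_of_pos_right _ (pos_iff_ne_zero.2 ((hf i (by omega)).2 hn))
    | succ j _ ih =>
      intro hn
      rw [clockTime_succ d (j + 1)]
      exact (ih (by omega)).trans_le le_self_add
  -- A successor is not a call, and all events before `C` are calls, so it lies at `C` or later.
  have hmatch : ∀ i, ∃ j, i < q → j < n ∧ clockTime d (j + 1) = clockTime d (i + 1) + 1 ∧
      C ≤ j ∧ y (j + 2) = F (y i) (y (i + 1)) (y (i + 2)) := by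
    intro i
    by_cases hi : i < q
    · have hp : p i ≠ .ret := by
        rcases Nat.lt_or_ge i C with hiC | hiC
        · rw [(hs.call i (Nat.zero_le _) hiC).1]; simp
        · rw [hs.int i hiC hi]; simp
      obtain ⟨j, h1, h2, h3, h4, h5⟩ := (hf i (by omega)).1 hp
      refine ⟨j, fun _ => ⟨h2, h3, ?_, h5⟩⟩
      by_contra hj
      exact h4 (hs.call j (Nat.zero_le _) (by omega)).1
    · exact ⟨0, fun h => absurd h hi⟩
  choose μ hμ using hmatch
  -- Both successors are delayed by exactly one unit, so they occur in the order of their events.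
  have hstep : ∀ i, i + 1 < q → μ i < μ (i + 1) := by
    intro i hi
    by_contra hcon
    have h1 := hμ i (by omega)
    have h2 := hμ (i + 1) hi
    have h3 : clockTime d (i + 1) < clockTime d (i + 1 + 1) := hmono i (i + 1) (by omega) (by omega)
    have h4 : clockTime d (μ (i + 1) + 1) ≤ clockTime d (μ i + 1) := by
      rcases Nat.eq_or_lt_of_le (not_lt.1 hcon) with h | h
      · rw [h]
      · exact (hmono _ _ h h1.1).le
    rw [h1.2.1, h2.2.1, add_le_add_iff_right] at h4
    exact absurd h3 (not_lt.2 h4)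
  have hlow : ∀ i, i < q → C + i ≤ μ i := by
    intro i
    induction i with
    | zero => exact fun h => (hμ 0 h).2.2.1
    | succ i ih =>
      intro h
      have := ih (by omega)
      have := hstep i h
      omega
  have hup : ∀ k i, i + k < q → μ i + k ≤ μ (i + k) := by
    intro k
    induction k with
    | zero => exact fun i _ => le_rfl
    | succ k ih =>
      intro i h
      have h1 := ih i (by omega)
      have h2 := hstep (i + k) h
      rw [← add_assoc i k 1]
      omega
  -- Squeeze: `μ i` has at least `i` successors before it from `C` on, and `q - 1 - i` successors
  -- after it before the end `n ≤ q + C`. This leaves only `μ i = i + C`.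
  have h1 := hlow i hi
  have h2 := hup (q - 1 - i) i (by omega)
  have h3 := (hμ (i + (q - 1 - i)) (by omega)).1
  have h4 := hs.end_le
  have h5 : μ i = i + C := by omega
  rw [← h5]
  exact (hμ i hi).2.2.2

lemma eq_helix_of_faultless (hs : HaltingShape H w p y 0 n C q)
    (hf : ∀ i < n, Faultless F p y d n i) (h0 : y 0 = marker) (h1 : y 1 = marker) {z : ℕ → S}
    (hz : IsHelix F marker C w z) : ∀ i < n + 2, y i = z i := by
  intro i
  induction i using Nat.strong_induction_on with
  | _ i ih =>
    intro hi
    rcases i with _ | _ | i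
    · rw [h0, hz.zero]
    · rw [h1, hz.one]
    · rcases Nat.lt_or_ge i C with hiC | hiC
      · rw [(hs.call i (Nat.zero_le _) hiC).2, hz.init i hiC]
      · obtain ⟨j, rfl⟩ : ∃ j, i = j + C := ⟨i - C, by omega⟩
        have := hs.end_le
        have := hs.lt
        have := hs.lt_end
        have := hs.le
        have hrule := eq_helix_rule_of_faultless hs hf (i := j) (by omega)
        change y (j + C + 2) = z (j + C + 2)
        -- `C = 0` would allow no return, but there is one at `q`; `0 < C` puts `j + 2` within reach
        -- of the induction hypothesis.
        rcases Nat.eq_zero_or_pos C with hC | hC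
        · omega
        · rw [hrule, hz.next, ih j (by omega) (by omega), ih (j + 1) (by omega) (by omega),
            ih (j + 2) (by omega) (by omega)]

/-- Placing the cells of a helix at distance `1 / C` gives a faultless word. -/
lemma exists_faultless_of_helix {z : ℕ → S} (hC : 0 < C) (hz : IsHelix F marker C w z)
    (hq : C < q) (hH : H (z (q + 2))) :
    ∃ p d, HaltingShape H w p z 0 (q + C) C q ∧ ∀ i < q + C, Faultless F p z d (q + C) i := by
  have hC' : (C : ℝ≥0) ≠ 0 := Nat.cast_ne_zero.2 hC.ne'
  have htime : ∀ k, clockTime (fun _ => (C : ℝ≥0)⁻¹) k = k * (C : ℝ≥0)⁻¹ := by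
    intro k
    simp [clockTime]
  refine ⟨fun i => if i < C then .call else if i < q then .int else .ret, fun _ => (C : ℝ≥0)⁻¹,
    ⟨Nat.zero_le _, hq, by omega, fun i _ hi => ⟨if_pos hi, hz.init i hi⟩, fun i h1 h2 => ?_,
      fun i h1 h2 => ?_, hH, le_rfl⟩, fun i hi => ⟨fun hp => ?_, fun _ => inv_ne_zero hC'⟩⟩
  · simp only [if_neg (not_lt.2 h1), if_pos h2]
  · simp only [if_neg (not_lt.2 h1), if_neg (not_lt.2 (hq.le.trans h1))]
  · have hiq : i < q := by
      by_contra hcon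
      have h1 : ¬ i < C := by omega
      simp [hcon, h1] at hp
    refine ⟨i + C, by omega, by omega, ?_, ?_, hz.next i⟩
    · rw [htime, htime]
      push_cast
      rw [show (i : ℝ≥0) + C + 1 = i + 1 + C by ring, add_mul, mul_inv_cancel₀ hC']
    · have h1 : ¬ i + C < C := by omega
      simp only [if_neg h1]
      split <;> simp

end Faultless

/-! ### The reduction -/

section Reduction

open Turing

variable {Γ Λ : Type} [Inhabited Γ] [Inhabited Λ]

/-- The input cells for the tape content `c₀ c₁ c₂ᵐ`. -/
def tapeCells (Λ : Type) [Inhabited Λ] (c₀ c₁ c₂ : Γ) : InputCells (Cell Γ Λ) where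
  blank := some (default, none)
  fst := some (c₀, some default)
  snd := some (c₁, none)
  rest := some (c₂, none)

lemma mk₁_nth_natCast (l : List Γ) (i : ℕ) : (Tape.mk₁ l).nth i = l.getI i := by
  rw [Tape.mk₁, Tape.mk₂, Tape.mk'_nth_nat, ListBlank.nth_mk]

lemma mk₁_nth_neg (l : List Γ) (z : ℤ) (hz : z < 0) : (Tape.mk₁ l).nth z = default := by
  obtain ⟨n, rfl⟩ := Int.eq_negSucc_of_lt_zero hz
  change ((Tape.mk₁ l).left).nth n = default
  simp [Tape.mk₁, Tape.mk₂, ListBlank.nth_mk]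

lemma tapeCells_word (c₀ c₁ c₂ : Γ) (m a r : ℕ) :
    (tapeCells Λ c₀ c₁ c₂).word m a r =
      cellAt (TM0.init (c₀ :: c₁ :: List.replicate m c₂)) 0 ((r : ℤ) - a) := by
  unfold InputCells.word cellAt
  simp only [sub_zero, TM0.init]
  rcases Nat.lt_or_ge r a with h | h
  · rw [if_pos h, mk₁_nth_neg _ _ (by omega), if_neg (by omega)]
    rfl
  · obtain ⟨i, rfl⟩ := Nat.exists_eq_add_of_le h
    rw [show ((a + i : ℕ) : ℤ) - a = (i : ℕ) by push_cast; ring, mk₁_nth_natCast,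
      if_neg (by omega)]
    rcases i with _ | _ | i
    · simp [tapeCells]
    · simp [tapeCells]
    · rw [if_neg (by omega), if_neg (by omega)]
      have hi0 : ((i + 1 + 1 : ℕ) : ℤ) ≠ 0 := by omega
      rw [if_neg hi0]
      rcases Nat.lt_or_ge i m with hi | hi
      · rw [if_pos (by omega)]
        simp [tapeCells, List.getI_eq_getElem?_getD, hi]
      · rw [if_neg (by omega)]
        simp [tapeCells, List.getI_eq_getElem?_getD, hi]

variable [Fintype Γ] [Fintype Λ] [Encodable (Cell Γ Λ)]

theorem language_subset_iff_not_halts (M : TM0.Machine Γ Λ) (c₀ c₁ c₂ : Γ) (m : ℕ) :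
    (haltingNet (tapeCells Λ c₀ c₁ c₂) (IsHalted M) m).language ⊆
        (faultAutomaton (localRule M) none).language ↔
      ¬ (TM0.eval M (c₀ :: c₁ :: List.replicate m c₂)).Dom := by
  rw [TPDA.language_subset_iff isTimedVisiblyOneCounterNet_haltingNet.1
    (sameAlphabet_haltingNet _ _)]
  constructor
  · intro h hdom
    obtain ⟨T, hT⟩ := exists_isHalted_helix hdom
    -- The window consists of the `m + 2` input cells and `T` blanks on each side.
    have hC : 2 * T < T + 2 + m + T := by omega
    obtain ⟨z, hz⟩ := exists_isHelix (localRule M) none (C := T + 2 + m + T) (by omega)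
      ((tapeCells Λ c₀ c₁ c₂).word m T)
    obtain ⟨q, hq, hhalt⟩ := hT _ _ z hC hz fun r _ => tapeCells_word _ _ _ _ _ _
    obtain ⟨p, d, hs, hf⟩ := exists_faultless_of_helix (H := IsHalted M) (by omega) hz hq hhalt
    refine (accepts_faultAutomaton_iff hz.zero hz.one _).1
      (h (cellWord p z d 0 (q + (T + 2 + m + T))) ?_ ?_) hf
    · rw [show q + (T + 2 + m + T) = q + (2 * T + m + 1) + 1 by omega, cellWord_succ]
      simp
    · exact (accepts_haltingNet_iff _).2 ⟨T, _, q, by omega, hs⟩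
  · intro h ρ _ hacc
    obtain ⟨p, y, d, h0, h1, hρ⟩ := exists_eq_cellWord (none : Cell Γ Λ) ρ (by
      intro a ha
      obtain ⟨s, -, -, -, s', hrun, -⟩ := hacc
      have := hrun.mem_alphabet isTimedVisiblyOneCounterNet_haltingNet.1 a ha
      obtain ⟨σ, -, hσ⟩ := List.mem_map.1 this
      exact ⟨σ, hσ⟩)
    rw [hρ] at hacc ⊢
    rw [accepts_faultAutomaton_iff h0 h1]
    -- A word of the net that is rejected as faultless agrees with a helix up to its end, in
    -- particular at the halted cell of its first return.
    intro hf
    obtain ⟨a, C, q, hC, hs⟩ := (accepts_haltingNet_iff _).1 hacc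
    obtain ⟨z, hz⟩ := exists_isHelix (localRule M) none (C := C) (by omega)
      ((tapeCells Λ c₀ c₁ c₂).word m a)
    have hyz := eq_helix_of_faultless hs hf h0 h1 hz
    refine h (eval_dom_of_helix hz (fun r _ => tapeCells_word _ _ _ _ _ _) (n := q + 2) ?_)
    rw [← hyz _ (by have := hs.lt_end; omega)]
    exact hs.halted

end Reduction

/-! ### Transfer of decidability along the reduction. -/

lemma DecidableOn.mono {α : Type} [Primcodable α] {D D' : Set α} {P : α → Prop}
    (h : DecidableOn D P) (hD : D' ⊆ D) : DecidableOn D' P := by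
  obtain ⟨f, hf, h⟩ := h
  exact ⟨f, hf, fun x hx => h x (hD hx)⟩

/-- A computable reduction to a decidable problem makes a predicate computable. -/
lemma DecidableOn.computablePred {α β : Type} [Primcodable α] [Primcodable β] {D : Set α}
    {P : α → Prop} (h : DecidableOn D P) {g : β → α} (hg : Computable g) (hD : ∀ b, g b ∈ D) :
    ComputablePred fun b => P (g b) := by
  classical
  obtain ⟨f, hf, h⟩ := h
  refine ComputablePred.computable_iff.2 ⟨fun b => decide (P (g b)), ?_, by simp⟩
  refine (hf.comp hg).of_eq fun b => ?_
  obtain ⟨v, hv, hP⟩ := h _ (hD b)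
  rw [Part.eq_some_iff.2 hv]
  refine congrArg Part.some ?_
  rw [Bool.eq_iff_iff, hP, decide_eq_true_iff]

theorem not_decidableOn_restrictedPairs :
    ¬ DecidableOn restrictedPairs fun p => p.1.language ⊆ p.2.language := by
  intro h
  obtain ⟨Γ, Λ, _, _, _, _, M, c₀, c₁, c₂, hM⟩ := exists_undecidable_TM0
  classical
  -- Any numbering of the finitely many cells will do, since it is fixed once and for all together
  -- with the machine.
  let _ : Encodable (Cell Γ Λ) := Fintype.toEncodable _
  have hcomp := h.computablePred (g := fun m => (haltingNet (tapeCells Λ c₀ c₁ c₂) (IsHalted M) m,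
      faultAutomaton (localRule M) none))
    ((computable_haltingNet _ _).pair (.const _)) fun m =>
      ⟨⟨isTimedVisiblyOneCounterNet_haltingNet, isTimedAutomaton_faultAutomaton,
        sameAlphabet_haltingNet _ _⟩, rfl,
        isDeterministic_haltingNet (by simp [tapeCells]), by
          simp [TPDA.AtMostOneClock, faultAutomaton]⟩
  exact hM (hcomp.not.of_eq fun m => by rw [language_subset_iff_not_halts, not_not])

end Timed

theorem mainTheorem1 :
    ¬ Timed.DecidableOn Timed.netAutomatonPairs (fun p => p.1.language ⊆ p.2.language) ∧
    ¬ Timed.DecidableOn Timed.restrictedPairs (fun p => p.1.language ⊆ p.2.language) :=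
  ⟨fun h => Timed.not_decidableOn_restrictedPairs (h.mono fun _ hp => hp.1),
    Timed.not_decidableOn_restrictedPairs⟩
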